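/- **Setting.** Let $d\ge 1$, let $\Omega\subset\mathbb R^d$ be a bounded open set (for instance a bounded polyhedral domain), and let $K>0$, $-1<\alpha<0$, $T>0$. Write $\langle\cdot,\cdot\rangle$ and $\|\cdot\|$ for the inner product and norm of $L_2(\Omega)$, let $H^1_0(\Omega)$ be the closure of $C_c^\infty(\Omega)$ in $H^1(\Omega)$, and put $$A(v,w)=K\int_\Omega\nabla v\cdot\nabla w\,dx\qquad(v,w\in H^1_0(\Omega)).$$ This is the bilinear form of $A=-\operatorname{div}(K\nabla)$ with homogeneous Dirichlet boundary conditions. For $F\in L_2(\Omega)$ let $A^{-1}F\in H^1_0(\Omega)$ be the unique element $w$ with $A(w,v)=\langle F,v\rangle$ for all $v\in H^1_0(\Omega)$. With $\omega_\mu(t)=t^{\mu-1}/\Gamma(\mu)$ let $$I^{-\alpha}v(t)=\int_0^t\omega_{-\alpha}(t-s)\,v(s)\,ds,\qquad \mathcal B_\alpha v(t)=\frac{d}{dt}\int_0^t\omega_{\alpha+1}(t-s)\,v(s)\,ds,\qquad d_\alpha=\frac1{\cos(\alpha\pi/2)}.$$ **The DG method** for $u'+\mathcal B_\alpha Au=f$.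 Let $0=t_0<t_1<\dots<t_N=T$, $I_n=(t_{n-1},t_n)$, and let $p_1,\dots,p_N\ge 0$ be integers; $\mathbb P_q$ is the space of polynomials in $t$ of degree at most $q$ with coefficients in $H^1_0(\Omega)$. Let $f\in L_1((0,T);L_2(\Omega))$ be such that $$\int_0^T\!\int_0^t\omega_{-\alpha}(t-s)\,\bigl|\langle f(s),A^{-1}f(t)\rangle\bigr|\,ds\,dt<\infty$$ (both conditions hold, for example, if $f\in L_2((0,T);L_2(\Omega))$), and let $U_-^0\in L_2(\Omega)$. A DG solution is a function $U$ with values in $H^1_0(\Omega)$ such that, for $1\le n\le N$, $U|_{I_n}\in\mathbb P_{p_n}$ and, for all $X\in\mathbb P_{p_n}$, $$\langle U_+^{n-1}-U_-^{n-1},X(t_{n-1})\rangle+\int_{t_{n-1}}^{t_n}\bigl(\langle U',X\rangle+A(\mathcal B_\alpha U,X)\bigr)dt=\int_{t_{n-1}}^{t_n}\langle f,X\rangle\,dt,$$ where $U_+^{n}=U(t_n^+)$ for $0\le n\le N-1$ and $U_-^n=U(t_n^-)$ for $1\le n\le N$ are one-sided limits. **Theorem.** Let $U$ be a DG solution. Then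 for every $1\le n\le N$ the functions $A(\mathcal B_\alpha U,U)$ and $\langle I^{-\alpha}f,A^{-1}f\rangle$ are integrable on $(0,t_n)$, and $$\|U_-^n\|^2+\|U_+^{n-1}\|^2+2\int_0^{t_n}A(\mathcal B_\alpha U,U)\,dt\le 4\|U_-^0\|^2+4d_\alpha^2\int_0^{t_n}\bigl|\langle I^{-\alpha}f,A^{-1}f\rangle\bigr|\,dt.$$ -/

import Mathlib

open MeasureTheory Set
open scoped ContDiff Gradient

noncomputable section

namespace Subdiffusion

/-! ### The spatial setting -/

/-- The space `L₂(Ω)`, with inner product `∫_Ω u v dx`. -/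
abbrev L2 {d : ℕ} (Ω : Set (EuclideanSpace ℝ (Fin d))) : Type :=
  Lp ℝ 2 (volume.restrict Ω)

/-- The space `L₂(Ω; ℝᵈ)` of square integrable vector fields. -/
abbrev L2Vec {d : ℕ} (Ω : Set (EuclideanSpace ℝ (Fin d))) : Type :=
  Lp (EuclideanSpace ℝ (Fin d)) 2 (volume.restrict Ω)

/-- The pairs `(φ, ∇φ)` with `φ ∈ C_c^∞(Ω)`. The ambient norm of a pair `(u, G)` is
`(‖u‖² + ‖G‖²)^(1/2)`, so that the norm of `(φ, ∇φ)` is the norm of `φ` in `H¹(Ω)`. -/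
def testPairs {d : ℕ} (Ω : Set (EuclideanSpace ℝ (Fin d))) :
    Submodule ℝ (WithLp 2 (L2 Ω × L2Vec Ω)) where
  carrier := {w | ∃ φ : EuclideanSpace ℝ (Fin d) → ℝ, ContDiff ℝ ∞ φ ∧ HasCompactSupport φ ∧
    tsupport φ ⊆ Ω ∧ w.fst =ᵐ[volume.restrict Ω] φ ∧ w.snd =ᵐ[volume.restrict Ω] ∇ φ}
  zero_mem' := by
    refine ⟨0, contDiff_const, HasCompactSupport.zero, by simp [tsupport], ?_, ?_⟩
    · exact Lp.coeFn_zero _ _ _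
    · filter_upwards [Lp.coeFn_zero (EuclideanSpace ℝ (Fin d)) 2 (volume.restrict Ω)] with x hx
      have h0 : ∇ (0 : EuclideanSpace ℝ (Fin d) → ℝ) x = 0 := by simp [gradient]
      rw [h0]
      exact hx
  add_mem' := by
    rintro v w ⟨φ, hφ, hφc, hφs, hv1, hv2⟩ ⟨ψ, hψ, hψc, hψs, hw1, hw2⟩
    refine ⟨φ + ψ, hφ.add hψ, hφc.add hψc,
      (tsupport_add φ ψ).trans (union_subset hφs hψs), ?_, ?_⟩
    · exact (Lp.coeFn_add v.fst w.fst).trans (hv1.add hw1)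
    · refine (Lp.coeFn_add v.snd w.snd).trans ?_
      filter_upwards [hv2, hw2] with x h1 h2
      have e1 := (hφ.differentiable (by simp)).differentiableAt (x := x)
      have e2 := (hψ.differentiable (by simp)).differentiableAt (x := x)
      simp only [Pi.add_apply, h1, h2, gradient, fderiv_add e1 e2, map_add]
  smul_mem' := by
    rintro c v ⟨φ, hφ, hφc, hφs, hv1, hv2⟩
    refine ⟨c • φ, contDiff_const.smul hφ, hφc.smul_left (f := fun _ => c),
      (tsupport_smul_subset_right (fun _ => c) φ).trans hφs, ?_, ?_⟩
    · exact (Lp.coeFn_smul c v.fst).trans (hv1.const_smul c)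
    · refine (Lp.coeFn_smul c v.snd).trans ?_
      filter_upwards [hv2] with x h1
      have e1 := (hφ.differentiable (by simp)).differentiableAt (x := x)
      simp only [Pi.smul_apply, h1, gradient, fderiv_const_smul e1, map_smul]

/-- The Sobolev space `H¹₀(Ω)`: the closure of `C_c^∞(Ω)` in the norm of `H¹(Ω)`. An element `u`
is stored as the pair of `u ∈ L₂(Ω)` and its weak gradient `∇u ∈ L₂(Ω; ℝᵈ)`. -/
def H10 {d : ℕ} (Ω : Set (EuclideanSpace ℝ (Fin d))) :
    Submodule ℝ (WithLp 2 (L2 Ω × L2Vec Ω)) :=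
  (testPairs Ω).topologicalClosure

instance {d : ℕ} (Ω : Set (EuclideanSpace ℝ (Fin d))) : CompleteSpace (H10 Ω) :=
  (Submodule.isClosed_topologicalClosure (testPairs Ω)).completeSpace_coe

/-- The embedding `H¹₀(Ω) → L₂(Ω)`. -/
def toL2 {d : ℕ} {Ω : Set (EuclideanSpace ℝ (Fin d))} (v : H10 Ω) : L2 Ω :=
  (v : WithLp 2 (L2 Ω × L2Vec Ω)).fst

/-- The weak gradient `∇ : H¹₀(Ω) → L₂(Ω; ℝᵈ)`. -/
def grad {d : ℕ} {Ω : Set (EuclideanSpace ℝ (Fin d))} (v : H10 Ω) : L2Vec Ω :=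
  (v : WithLp 2 (L2 Ω × L2Vec Ω)).snd

/-- The bilinear form `A(v, w) = K ⟨∇v, ∇w⟩` of `A = -div(K ∇)` with homogeneous Dirichlet
boundary conditions. -/
def bilinA {d : ℕ} {Ω : Set (EuclideanSpace ℝ (Fin d))} (K : ℝ) (v w : H10 Ω) : ℝ :=
  K * inner ℝ (grad v) (grad w)

/-- `A w = F` in the weak sense, with `w = 0` on the boundary. -/
def SolvesA {d : ℕ} {Ω : Set (EuclideanSpace ℝ (Fin d))} (K : ℝ) (F : L2 Ω) (w : H10 Ω) : Prop :=
  ∀ v : H10 Ω, bilinA K w v = inner ℝ F (toL2 v)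

open Classical in
/-- The inverse `A⁻¹ : L₂(Ω) → H¹₀(Ω)`: `A⁻¹ F` is the weak solution `w` of `A w = F`. For bounded
open `Ω` (in dimension at least one) and `K > 0` it exists and is unique, and the value `0` of the
last branch is never taken. -/
def invA {d : ℕ} {Ω : Set (EuclideanSpace ℝ (Fin d))} (K : ℝ) (F : L2 Ω) : H10 Ω :=
  if h : ∃ w : H10 Ω, SolvesA K F w then h.choose else 0

/-! ### Fractional integrals and derivatives in time -/

/-- The kernel `ω_μ(t) = t^(μ-1) / Γ(μ)`. -/
def omega (μ t : ℝ) : ℝ := t ^ (μ - 1) / Real.Gamma μ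

/-- The Riemann–Liouville integral `I^μ v(t) = ∫₀ᵗ ω_μ(t-s) v(s) ds`. -/
def fracInt {E : Type*} [NormedAddCommGroup E] [NormedSpace ℝ E] (μ : ℝ) (v : ℝ → E) (t : ℝ) : E :=
  ∫ s in (0 : ℝ)..t, omega μ (t - s) • v s

/-- The Riemann–Liouville derivative `B_α v(t) = d/dt ∫₀ᵗ ω_{α+1}(t-s) v(s) ds` of order `-α`. -/
def fracDeriv {E : Type*} [NormedAddCommGroup E] [NormedSpace ℝ E] (α : ℝ) (v : ℝ → E) (t : ℝ) :
    E :=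
  deriv (fracInt (α + 1) v) t

/-! ### The discontinuous Galerkin method -/

/-- A partition `0 = t₀ < t₁ < ⋯ < t_N = T` (only `t n` with `n ≤ N` matters). -/
structure TimeMesh (T : ℝ) where
  N : ℕ
  t : ℕ → ℝ
  t_zero : t 0 = 0
  t_last : t N = T
  t_lt : ∀ n, 1 ≤ n → n ≤ N → t (n - 1) < t n

/-- `X` is a polynomial of degree at most `q` in time, with coefficients in `E`. -/
def IsPoly {E : Type*} [AddCommGroup E] [Module ℝ E] (q : ℕ) (X : ℝ → E) : Prop :=
  ∃ c : ℕ → E, ∀ t, X t = ∑ i ∈ Finset.range (q + 1), t ^ i • c i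

/-- The space `W(M, p)`: on each open interval `I_n = (t_{n-1}, t_n)` the function `v` is a
polynomial of degree at most `p n` with coefficients in `H¹₀(Ω)`. -/
def InDGSpace {d : ℕ} {Ω : Set (EuclideanSpace ℝ (Fin d))} {T : ℝ} (M : TimeMesh T) (p : ℕ → ℕ)
    (v : ℝ → H10 Ω) : Prop :=
  ∀ n, 1 ≤ n → n ≤ M.N → ∃ P : ℝ → H10 Ω, IsPoly (p n) P ∧ EqOn v P (Ioo (M.t (n - 1)) (M.t n))

/-- The trace `U_+^n = U(t_n⁺)` in `L₂(Ω)`. -/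
def tracePlus {d : ℕ} {Ω : Set (EuclideanSpace ℝ (Fin d))} {T : ℝ} (M : TimeMesh T)
    (U : ℝ → H10 Ω) (n : ℕ) : L2 Ω :=
  toL2 (Function.rightLim U (M.t n))

/-- The trace `U_-^n = U(t_n⁻)` in `L₂(Ω)` for `n ≥ 1`; `U_-^0` is the prescribed initial
value `U₀`. -/
def traceMinus {d : ℕ} {Ω : Set (EuclideanSpace ℝ (Fin d))} {T : ℝ} (M : TimeMesh T) (U₀ : L2 Ω)
    (U : ℝ → H10 Ω) (n : ℕ) : L2 Ω :=
  if n = 0 then U₀ else toL2 (Function.leftLim U (M.t n))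

/-- `U` is the time-stepping discontinuous Galerkin solution of `u' + B_α A u = f`,
`A = -div(K ∇)`, on the mesh `M` with degrees `p`, source `f` and starting value `U_-^0 = U₀`. -/
def IsDGSolution {d : ℕ} {Ω : Set (EuclideanSpace ℝ (Fin d))} {T : ℝ} (K α : ℝ) (M : TimeMesh T)
    (p : ℕ → ℕ) (f : ℝ → L2 Ω) (U₀ : L2 Ω) (U : ℝ → H10 Ω) : Prop :=
  InDGSpace M p U ∧
    ∀ n, 1 ≤ n → n ≤ M.N → ∀ X : ℝ → H10 Ω, IsPoly (p n) X →
      inner ℝ (tracePlus M U (n - 1) - traceMinus M U₀ U (n - 1)) (toL2 (X (M.t (n - 1))))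
        + ∫ t in M.t (n - 1)..M.t n,
            (inner ℝ (toL2 (deriv U t)) (toL2 (X t)) + bilinA K (fracDeriv α U t) (X t))
      = ∫ t in M.t (n - 1)..M.t n, inner ℝ (f t) (toL2 (X t))

/-- The constant `d_α = 1 / cos(απ/2)`. -/
def dConst (α : ℝ) : ℝ := 1 / Real.cos (α * Real.pi / 2)

end Subdiffusion

end

/-!
Put `β = -α`. Testing the scheme with `U` on each interval gives the energy balance
`‖U_-ⁿ‖² + ∑ ‖jumps‖² + 2 ∫ A(𝓑_αU, U) = ‖U_-⁰‖² + 2 ∫ ⟨f, U⟩`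
(`IsDGSolution.energy_step`, `IsDGSolution.energy_le`), so everything rests on bounding `∫ ⟨f, U⟩`.

Let `g = ∇𝓑_αU` and `W = ∇A⁻¹f`, both restricted to `(0, t_n)`. Off the mesh, `U` is a finite sum
of truncated powers (`exists_eq_kernelSum_of_piecewise_isPoly`), hence so is `𝓑_αU`, and
`U = I^β 𝓑_αU` by the semigroup property of the kernels `ω_μ`. With
`Φ(u, v) = ∬_{s<t} ω_β(t - s) ⟨u(s), v(t)⟩` this turns the three time integrals into
`∫ A(𝓑_αU, U) = K Φ(g, g)`, `∫ ⟨f, U⟩ = K Φ(g, W)` and `∫ ⟨I^βf, A⁻¹f⟩ = K Φ(W, W)`.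

The sector inequality `2 Φ(g, W) ≤ r Φ(g, g) + (d_α² / r) Φ(W, W)` (`two_mul_causalForm_le`) comes
from splitting `ω_β` as the convolution of two copies of `ω_{β/2}`: `Φ(g, W)` is the `L₂(ℝ)` pairing
of the causal half-integral of `g` with the anticausal half-integral of `W`. The squared norm of
the former is `d_α Φ(g, g)`, that of the latter is `d_α Φ(W, W)`, because the overlap integral
`∫ ω_{β/2}(y - s) ω_{β/2}(y - t) dy` over `y > max(s, t)` equals `(d_α / 2) ω_β(|t - s|)`
(`integral_gap`). All integrals are taken over the whole line, so no Fourier transform is needed,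
and Fubini's theorem only requires the absolute convergence that is assumed of `f`.

The operator `A⁻¹` is obtained from the Poincaré inequality and the Lax–Milgram theorem
(`exists_invA_eq`). In the last step the sector inequality is used with `r = 2` up to `t_{n-1}` and
with `r = 1` up to `t_n`, and `‖U_+^{n-1}‖² ≤ 2 ‖U_+^{n-1} - U_-^{n-1}‖² + 2 ‖U_-^{n-1}‖²`.
-/

namespace Subdiffusion

/-! ### The causal kernels -/

/-- The kernel `ω_μ`, extended by zero to the negative half-line, so that Riemann–Liouville
integrals become convolutions on `ℝ`. -/
noncomputable def causalKernel (μ x : ℝ) : ℝ := (Ioi 0).indicator (omega μ) x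

theorem causalKernel_of_pos {μ x : ℝ} (hx : 0 < x) :
    causalKernel μ x = x ^ (μ - 1) / Real.Gamma μ := by
  simp [causalKernel, hx, omega]

theorem causalKernel_of_nonpos {μ x : ℝ} (hx : x ≤ 0) : causalKernel μ x = 0 := by
  simp [causalKernel, hx]

theorem causalKernel_nonneg {μ : ℝ} (hμ : 0 < μ) (x : ℝ) : 0 ≤ causalKernel μ x := by
  rcases lt_or_ge 0 x with hx | hx
  · rw [causalKernel_of_pos hx]
    have := Real.Gamma_pos_of_pos hμ
    positivity
  · rw [causalKernel_of_nonpos hx]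

theorem measurable_causalKernel (μ : ℝ) : Measurable (causalKernel μ) := by
  unfold causalKernel omega
  exact Measurable.indicator (by fun_prop) measurableSet_Ioi

theorem betaPDFReal_nonneg {μ ν : ℝ} (hμ : 0 < μ) (hν : 0 < ν) (x : ℝ) :
    0 ≤ ProbabilityTheory.betaPDFReal μ ν x := by
  by_cases h : 0 < x ∧ x < 1
  · exact (ProbabilityTheory.betaPDFReal_pos h.1 h.2 hμ hν).le
  · simp [ProbabilityTheory.betaPDFReal, h]

theorem integrable_betaPDFReal {μ ν : ℝ} (hμ : 0 < μ) (hν : 0 < ν) :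
    Integrable (ProbabilityTheory.betaPDFReal μ ν) := by
  refine ⟨(ProbabilityTheory.measurable_betaPDFReal μ ν).aestronglyMeasurable, ?_⟩
  rw [hasFiniteIntegral_iff_ofReal]
  · have := ProbabilityTheory.lintegral_betaPDF_eq_one hμ hν
    simp only [ProbabilityTheory.betaPDF] at this
    rw [this]; exact ENNReal.one_lt_top
  · filter_upwards with x
    exact betaPDFReal_nonneg hμ hν x

theorem integral_betaPDFReal {μ ν : ℝ} (hμ : 0 < μ) (hν : 0 < ν) :
    ∫ x, ProbabilityTheory.betaPDFReal μ ν x = 1 := by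
  rw [integral_eq_lintegral_of_nonneg_ae]
  · have := ProbabilityTheory.lintegral_betaPDF_eq_one hμ hν
    simp only [ProbabilityTheory.betaPDF] at this
    rw [this]; rfl
  · filter_upwards with x
    exact betaPDFReal_nonneg hμ hν x
  · exact (ProbabilityTheory.measurable_betaPDFReal μ ν).aestronglyMeasurable

theorem causalKernel_mul_eq_betaPDFReal {μ ν s t : ℝ} (hμ : 0 < μ) (hν : 0 < ν) (hst : s < t)
    (y : ℝ) : causalKernel μ (t - y) * causalKernel ν (y - s) =
      causalKernel (μ + ν) (t - s) * (t - s)⁻¹ *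
        ProbabilityTheory.betaPDFReal ν μ ((y - s) / (t - s)) := by
  have hd : 0 < t - s := sub_pos.2 hst
  have h1 : 0 < (y - s) / (t - s) ↔ 0 < y - s := by
    rw [div_pos_iff_of_pos_right hd]
  have h2 : (y - s) / (t - s) < 1 ↔ 0 < t - y := by
    rw [div_lt_one hd]; constructor <;> intro h <;> linarith
  unfold ProbabilityTheory.betaPDFReal
  rcases le_or_gt (t - y) 0 with h | h
  · rw [causalKernel_of_nonpos h, if_neg (by rw [h2]; exact fun h' => absurd h'.2 h.not_gt)]
    simp
  rcases le_or_gt (y - s) 0 with h' | h'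
  · rw [causalKernel_of_nonpos h', if_neg (by rw [h1]; exact fun h'' => absurd h''.1 h'.not_gt)]
    simp
  rw [if_pos ⟨h1.2 h', h2.2 h⟩, causalKernel_of_pos h, causalKernel_of_pos h',
    causalKernel_of_pos hd]
  have e1 : 1 - (y - s) / (t - s) = (t - y) / (t - s) := by field_simp; ring
  rw [e1, Real.div_rpow h'.le hd.le, Real.div_rpow h.le hd.le, ProbabilityTheory.beta]
  have g1 := (Real.Gamma_pos_of_pos hμ).ne'
  have g2 := (Real.Gamma_pos_of_pos hν).ne'
  have g3 := (Real.Gamma_pos_of_pos (add_pos hμ hν)).ne'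
  have e2 : (t - s) ^ (μ + ν - 1) = (t - s) ^ (μ - 1) * (t - s) ^ (ν - 1) * (t - s) := by
    rw [← Real.rpow_add hd, ← Real.rpow_add_one hd.ne']; congr 1; ring
  have p1 := (Real.rpow_pos_of_pos hd (μ - 1)).ne'
  have p2 := (Real.rpow_pos_of_pos hd (ν - 1)).ne'
  rw [e2, add_comm ν μ]
  field_simp

theorem causalKernel_mul_eq_zero {μ ν s t : ℝ} (hst : t ≤ s) (y : ℝ) :
    causalKernel μ (t - y) * causalKernel ν (y - s) = 0 := by
  rcases le_or_gt (t - y) 0 with h | h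
  · rw [causalKernel_of_nonpos h, zero_mul]
  · rw [causalKernel_of_nonpos (x := y - s) (by linarith), mul_zero]

theorem integrable_causalKernel_mul {μ ν : ℝ} (hμ : 0 < μ) (hν : 0 < ν) (s t : ℝ) :
    Integrable (fun y => causalKernel μ (t - y) * causalKernel ν (y - s)) := by
  rcases le_or_gt t s with h | h
  · simp only [causalKernel_mul_eq_zero h]; exact integrable_zero _ _ _
  · simp only [causalKernel_mul_eq_betaPDFReal hμ hν h]
    have hd : t - s ≠ 0 := (sub_pos.2 h).ne'
    exact (((integrable_betaPDFReal hν hμ).comp_div hd).comp_sub_right s).const_mul _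

/-- The semigroup property `ω_μ * ω_ν = ω_{μ+ν}`: a rescaled Beta integral. -/
theorem integral_causalKernel_mul {μ ν : ℝ} (hμ : 0 < μ) (hν : 0 < ν) (s t : ℝ) :
    ∫ y, causalKernel μ (t - y) * causalKernel ν (y - s) = causalKernel (μ + ν) (t - s) := by
  rcases le_or_gt t s with h | h
  · simp only [causalKernel_mul_eq_zero h, integral_zero]
    rw [causalKernel_of_nonpos (by linarith)]
  · simp only [causalKernel_mul_eq_betaPDFReal hμ hν h]
    have hd : 0 < t - s := sub_pos.2 h
    rw [integral_const_mul,
      integral_sub_right_eq_self (fun y => ProbabilityTheory.betaPDFReal ν μ (y / (t - s))) s,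
      Measure.integral_comp_div, integral_betaPDFReal hν hμ, abs_of_pos hd]
    simp only [smul_eq_mul, mul_one]
    field_simp

theorem image_add_div_Ioo {s t : ℝ} (h : s < t) :
    (fun x => s + (t - s) / x) '' Ioo 0 1 = Ioi t := by
  have hd : 0 < t - s := sub_pos.2 h
  ext y
  simp only [mem_image, mem_Ioo, mem_Ioi]
  constructor
  · rintro ⟨x, ⟨hx0, hx1⟩, rfl⟩
    have : t - s < (t - s) / x := by rw [lt_div_iff₀ hx0]; nlinarith
    linarith
  · intro hy
    have hy' : 0 < y - s := by linarith
    refine ⟨(t - s) / (y - s), ⟨by positivity, ?_⟩, ?_⟩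
    · rw [div_lt_one hy']; linarith
    · field_simp; ring

/-- The substitution `y = s + (t - s) / x` turns `ω_a(y - s) ω_a(y - t)` into a Beta density. The
reflection formula for `Γ`, at `a` and at `2a`, produces the cosine in the constant. -/
theorem gap_integrand_eq {a s t x : ℝ} (ha : 0 < a) (ha' : a < 1 / 2) (h : s < t)
    (hx : x ∈ Ioo (0 : ℝ) 1) :
    |-(t - s) / x ^ 2| • (causalKernel a (s + (t - s) / x - s) *
        causalKernel a (s + (t - s) / x - t)) =
      causalKernel (2 * a) (t - s) * (2 * Real.cos (Real.pi * a))⁻¹ *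
        ProbabilityTheory.betaPDFReal (1 - 2 * a) a x := by
  obtain ⟨hx0, hx1⟩ := hx
  have hd : 0 < t - s := sub_pos.2 h
  have hx1' : 0 < 1 - x := by linarith
  have e1 : s + (t - s) / x - s = (t - s) / x := by ring
  have e2 : s + (t - s) / x - t = (t - s) * (1 - x) / x := by field_simp; ring
  have e3 : |-(t - s) / x ^ 2| = (t - s) / x ^ 2 := by
    rw [neg_div, abs_neg, abs_of_pos (by positivity)]
  rw [e1, e2, e3, causalKernel_of_pos (by positivity), causalKernel_of_pos (by positivity),
    causalKernel_of_pos hd, ProbabilityTheory.betaPDFReal, if_pos ⟨hx0, hx1⟩,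
    ProbabilityTheory.beta, Real.div_rpow hd.le hx0.le, Real.div_rpow (by positivity) hx0.le,
    Real.mul_rpow hd.le hx1'.le]
  have r1 : (t - s) ^ (2 * a - 1) = (t - s) ^ (a - 1) * (t - s) ^ (a - 1) * (t - s) := by
    rw [← Real.rpow_add hd, ← Real.rpow_add_one hd.ne']; congr 1; ring
  have r2 : x ^ (1 - 2 * a - 1) * (x ^ (a - 1) * x ^ (a - 1) * x ^ 2) = 1 := by
    rw [← Real.rpow_natCast x 2, ← Real.rpow_add hx0, ← Real.rpow_add hx0, ← Real.rpow_add hx0]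
    convert Real.rpow_zero x using 2
    push_cast; ring
  have g1 := (Real.Gamma_pos_of_pos ha).ne'
  have g2 := (Real.Gamma_pos_of_pos (show 0 < 1 - a by linarith)).ne'
  have g3 := (Real.Gamma_pos_of_pos (show 0 < 2 * a by linarith)).ne'
  have g4 := (Real.Gamma_pos_of_pos (show 0 < 1 - 2 * a by linarith)).ne'
  have hs : 0 < Real.sin (Real.pi * a) :=
    Real.sin_pos_of_pos_of_lt_pi (by positivity) (by nlinarith [Real.pi_pos])
  have hc : 0 < Real.cos (Real.pi * a) :=
    Real.cos_pos_of_mem_Ioo ⟨by nlinarith [Real.pi_pos], by nlinarith [Real.pi_pos]⟩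
  have q1 := Real.Gamma_mul_Gamma_one_sub a
  have q2 := Real.Gamma_mul_Gamma_one_sub (2 * a)
  rw [show Real.pi * (2 * a) = 2 * (Real.pi * a) by ring, Real.sin_two_mul] at q2
  have q3 : Real.Gamma a * Real.Gamma (1 - a) =
      2 * Real.cos (Real.pi * a) * (Real.Gamma (2 * a) * Real.Gamma (1 - 2 * a)) := by
    rw [q1, q2]; field_simp
  have p1 := (Real.rpow_pos_of_pos hx0 (a - 1)).ne'
  have e4 : x ^ (1 - 2 * a - 1) = (x ^ (a - 1) * x ^ (a - 1) * x ^ 2)⁻¹ :=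
    eq_inv_of_mul_eq_one_left r2
  rw [r1, e4, show 1 - 2 * a + a = 1 - a by ring, smul_eq_mul]
  replace hc := hc.ne'
  clear q1 q2
  generalize Real.Gamma (2 * a) = G₁ at *
  generalize Real.Gamma (1 - 2 * a) = G₂ at *
  generalize Real.cos (Real.pi * a) = c at *
  field_simp
  linear_combination -q3

theorem integrable_and_integral_gap_of_lt {a s t : ℝ} (ha : 0 < a) (ha' : a < 1 / 2)
    (h : s < t) :
    Integrable (fun y => causalKernel a (y - s) * causalKernel a (y - t)) ∧
    ∫ y, causalKernel a (y - s) * causalKernel a (y - t) =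
      (2 * Real.cos (Real.pi * a))⁻¹ * causalKernel (2 * a) (t - s) := by
  have hsupp : ∀ y, y ∉ Ioi t → causalKernel a (y - s) * causalKernel a (y - t) = 0 := by
    intro y hy
    rw [causalKernel_of_nonpos (x := y - t) (by simpa using hy), mul_zero]
  have hder : ∀ x ∈ Ioo (0 : ℝ) 1, HasDerivWithinAt (fun x => s + (t - s) / x)
      (-(t - s) / x ^ 2) (Ioo 0 1) x := by
    intro x hx
    have := ((hasDerivAt_inv hx.1.ne').const_mul (t - s)).const_add s
    refine (this.congr_deriv ?_).hasDerivWithinAt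
    field_simp
  have hinj : InjOn (fun x => s + (t - s) / x) (Ioo 0 1) := by
    intro x hx y hy hxy
    have hd : t - s ≠ 0 := (sub_pos.2 h).ne'
    have := hx.1.ne'
    have := hy.1.ne'
    simp only [add_right_inj] at hxy
    field_simp at hxy
    exact hxy.symm
  have hpdf : ∀ x, x ∉ Ioo (0 : ℝ) 1 →
      ProbabilityTheory.betaPDFReal (1 - 2 * a) a x = 0 := by
    intro x hx
    exact if_neg hx
  have hI := integrable_betaPDFReal (μ := 1 - 2 * a) (by linarith) ha
  constructor
  · rw [← integrableOn_iff_integrable_of_support_subset (s := Ioi t)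
      (fun y hy => by_contra fun h' => hy (hsupp y h')), ← image_add_div_Ioo h,
      integrableOn_image_iff_integrableOn_abs_deriv_smul measurableSet_Ioo hder hinj]
    refine IntegrableOn.congr_fun (hI.const_mul _).integrableOn
      (fun x hx => (gap_integrand_eq ha ha' h hx).symm) measurableSet_Ioo
  · rw [← setIntegral_eq_integral_of_forall_compl_eq_zero hsupp, ← image_add_div_Ioo h,
      integral_image_eq_integral_abs_deriv_smul measurableSet_Ioo hder hinj,
      setIntegral_congr_fun measurableSet_Ioo
        (fun x hx => gap_integrand_eq ha ha' h hx), integral_const_mul,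
      setIntegral_eq_integral_of_forall_compl_eq_zero hpdf,
      integral_betaPDFReal (by linarith) ha]
    ring

theorem integrable_gap {a s t : ℝ} (ha : 0 < a) (ha' : a < 1 / 2) (h : s ≠ t) :
    Integrable (fun y => causalKernel a (y - s) * causalKernel a (y - t)) := by
  rcases lt_or_gt_of_ne h with h | h
  · exact (integrable_and_integral_gap_of_lt ha ha' h).1
  · simpa only [mul_comm] using (integrable_and_integral_gap_of_lt ha ha' h).1

/-- The composition of `ω_a *` with its adjoint is convolution with the symmetrised kernel of
order `2a`. -/
theorem integral_gap {a s t : ℝ} (ha : 0 < a) (ha' : a < 1 / 2) (h : s ≠ t) :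
    ∫ y, causalKernel a (y - s) * causalKernel a (y - t) =
      (2 * Real.cos (Real.pi * a))⁻¹ *
        (causalKernel (2 * a) (t - s) + causalKernel (2 * a) (s - t)) := by
  rcases lt_or_gt_of_ne h with h | h
  · rw [(integrable_and_integral_gap_of_lt ha ha' h).2,
      causalKernel_of_nonpos (x := s - t) (by linarith), add_zero]
  · simp only [mul_comm (causalKernel a (_ - s))]
    rw [(integrable_and_integral_gap_of_lt ha ha' h).2,
      causalKernel_of_nonpos (x := t - s) (by linarith), zero_add]

theorem integrable_gap_reflected {a s t : ℝ} (ha : 0 < a) (ha' : a < 1 / 2) (h : s ≠ t) :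
    Integrable (fun y => causalKernel a (s - y) * causalKernel a (t - y)) := by
  have := (integrable_gap ha ha' (neg_injective.ne h)).comp_neg
  simpa only [sub_neg_eq_add, neg_add_eq_sub] using this

theorem integral_gap_reflected {a s t : ℝ} (ha : 0 < a) (ha' : a < 1 / 2) (h : s ≠ t) :
    ∫ y, causalKernel a (s - y) * causalKernel a (t - y) =
      (2 * Real.cos (Real.pi * a))⁻¹ *
        (causalKernel (2 * a) (t - s) + causalKernel (2 * a) (s - t)) := by
  have h1 := integral_gap ha ha' (neg_injective.ne h)
  rw [← integral_neg_eq_self] at h1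
  simp only [sub_neg_eq_add, neg_add_eq_sub] at h1
  rw [h1, add_comm]

/-! ### The sector inequality for the fractional integral -/

section Fubini

variable {E : Type*} [NormedAddCommGroup E] [InnerProductSpace ℝ E] [CompleteSpace E]

/-- Fubini's theorem for the `L₂` pairing of two integral transforms with nonnegative kernels
`k₁`, `k₂`. Absolute convergence is only required of the integral against the composed kernel `m`,
after the inner product of the two densities has been taken. -/
theorem integral_inner_integral_smul {k₁ k₂ : ℝ → ℝ → ℝ} {m : ℝ × ℝ → ℝ} {u v : ℝ → E}
    (hk₁ : Measurable (Function.uncurry k₁)) (hk₂ : Measurable (Function.uncurry k₂))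
    (h₁ : ∀ y s, 0 ≤ k₁ y s) (h₂ : ∀ y s, 0 ≤ k₂ y s)
    (hu : AEStronglyMeasurable u) (hv : AEStronglyMeasurable v)
    (hint : ∀ᵐ z : ℝ × ℝ, Integrable (fun y => k₁ y z.1 * k₂ y z.2))
    (hm : ∀ᵐ z : ℝ × ℝ, ∫ y, k₁ y z.1 * k₂ y z.2 = m z)
    (hmi : Integrable (fun z : ℝ × ℝ => m z * inner ℝ (u z.1) (v z.2)))
    (hu' : ∀ᵐ y, Integrable (fun s => k₁ y s • u s))
    (hv' : ∀ᵐ y, Integrable (fun s => k₂ y s • v s)) :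
    Integrable (fun y => inner ℝ (∫ s, k₁ y s • u s) (∫ s, k₂ y s • v s)) ∧
    ∫ y, inner ℝ (∫ s, k₁ y s • u s) (∫ s, k₂ y s • v s) =
      ∫ z : ℝ × ℝ, m z * inner ℝ (u z.1) (v z.2) := by
  let F : ℝ × (ℝ × ℝ) → ℝ := fun p =>
    (k₁ p.1 p.2.1 * k₂ p.1 p.2.2) * inner ℝ (u p.2.1) (v p.2.2)
  have hFm : AEStronglyMeasurable F (volume.prod volume) := by
    have a1 : Measurable fun p : ℝ × (ℝ × ℝ) => k₁ p.1 p.2.1 :=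
      hk₁.comp (measurable_fst.prodMk (measurable_fst.comp measurable_snd))
    have a2 : Measurable fun p : ℝ × (ℝ × ℝ) => k₂ p.1 p.2.2 :=
      hk₂.comp (measurable_fst.prodMk (measurable_snd.comp measurable_snd))
    have a3 : AEStronglyMeasurable (fun z : ℝ × ℝ => inner ℝ (u z.1) (v z.2))
        (volume.prod volume) := hu.comp_fst.inner hv.comp_snd
    exact (a1.mul a2).aestronglyMeasurable.mul a3.comp_snd
  have hF : Integrable F (volume.prod volume) := by
    rw [integrable_prod_iff' hFm]
    constructor
    · filter_upwards [hint] with z hz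
      exact hz.mul_const (inner ℝ (u z.1) (v z.2))
    · refine hmi.norm.congr ?_
      filter_upwards [hm] with z hz
      have h0 : ∀ y, ‖F (y, z)‖ = (k₁ y z.1 * k₂ y z.2) * ‖inner ℝ (u z.1) (v z.2)‖ := by
        intro y
        rw [norm_mul, Real.norm_of_nonneg (mul_nonneg (h₁ _ _) (h₂ _ _))]
      simp only [h0]
      rw [integral_mul_const, hz, norm_mul, Real.norm_of_nonneg]
      rw [← hz]
      exact integral_nonneg fun y => mul_nonneg (h₁ _ _) (h₂ _ _)
  have key : ∀ᵐ y, ∫ z, F (y, z) = inner ℝ (∫ s, k₁ y s • u s) (∫ s, k₂ y s • v s) := by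
    filter_upwards [hu', hv'] with y hy1 hy2
    refine Eq.trans ?_ (integral_prod_bilin (innerSL ℝ (E := E)) hy1 hy2)
    refine integral_congr_ae (Filter.Eventually.of_forall fun z => ?_)
    change _ = inner ℝ (k₁ y z.1 • u z.1) (k₂ y z.2 • v z.2)
    simp only [F, real_inner_smul_left, real_inner_smul_right]
    ring
  constructor
  · exact hF.integral_prod_left.congr key
  · rw [← integral_congr_ae key, ← integral_prod _ hF, integral_prod_symm _ hF]
    refine integral_congr_ae ?_
    filter_upwards [hm] with z hz
    simp only [F]
    rw [integral_mul_const, hz]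

end Fubini

theorem causalKernel_one {x : ℝ} (hx : 0 < x) : causalKernel 1 x = 1 := by
  simp [causalKernel_of_pos hx]

theorem causalKernel_mono {μ : ℝ} (hμ : 1 ≤ μ) : Monotone (causalKernel μ) := by
  intro x y hxy
  rcases le_or_gt x 0 with hx | hx
  · rw [causalKernel_of_nonpos hx]
    exact causalKernel_nonneg (by linarith) y
  · rw [causalKernel_of_pos hx, causalKernel_of_pos (hx.trans_le hxy)]
    have := Real.Gamma_pos_of_pos (show 0 < μ by linarith)
    gcongr

section Convolution

variable {E : Type*} [NormedAddCommGroup E] [NormedSpace ℝ E]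

/-- The Riemann–Liouville integral of an integrable function whose support is bounded below
converges absolutely almost everywhere. The factor `ω₁(R - y)` cuts the outer variable off at `R`,
and by the semigroup property the remaining `y`-integral is a bounded function of `s`. -/
theorem ae_integrable_causalKernel_smul {μ b : ℝ} (hμ : 0 < μ) {u : ℝ → E} (hu : Integrable u)
    (hb : ∀ s, s < b → u s = 0) :
    ∀ᵐ y, Integrable (fun s => causalKernel μ (y - s) • u s) := by
  have key : ∀ R : ℕ, ∀ᵐ y, Integrable
      (fun s => (causalKernel 1 (R - y) * causalKernel μ (y - s)) • u s) := by
    intro R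
    let F : ℝ × ℝ → E := fun p => (causalKernel 1 (R - p.1) * causalKernel μ (p.1 - p.2)) • u p.2
    have hFm : AEStronglyMeasurable F (volume.prod volume) := by
      have a1 : Measurable fun p : ℝ × ℝ =>
          causalKernel 1 (R - p.1) * causalKernel μ (p.1 - p.2) :=
        ((measurable_causalKernel 1).comp (by fun_prop)).mul
          ((measurable_causalKernel μ).comp (by fun_prop))
      exact a1.aestronglyMeasurable.smul hu.aestronglyMeasurable.comp_snd
    have hF : Integrable F (volume.prod volume) := by
      rw [integrable_prod_iff' hFm]
      constructor
      · filter_upwards with s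
        exact (integrable_causalKernel_mul one_pos hμ s R).smul_const (u s)
      · have h0 : ∀ s, ∫ y, ‖F (y, s)‖ = causalKernel (1 + μ) (R - s) * ‖u s‖ := by
          intro s
          simp only [F, norm_smul, Real.norm_of_nonneg (mul_nonneg (causalKernel_nonneg one_pos _)
            (causalKernel_nonneg hμ _))]
          rw [integral_mul_const, integral_causalKernel_mul one_pos hμ]
        simp only [h0]
        refine (hu.norm.const_mul (causalKernel (1 + μ) (R - b))).mono'
          ((((measurable_causalKernel _).comp (by fun_prop)).aestronglyMeasurable).mul
            hu.aestronglyMeasurable.norm) (Filter.Eventually.of_forall fun s => ?_)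
        rw [Real.norm_of_nonneg
          (mul_nonneg (causalKernel_nonneg (by linarith) _) (norm_nonneg _))]
        rcases lt_or_ge s b with hs | hs
        · simp [hb s hs]
        · gcongr
          exact causalKernel_mono (by linarith) (by linarith)
    exact hF.prod_right_ae
  filter_upwards [ae_all_iff.2 key] with y hy
  obtain ⟨R, hR⟩ := exists_nat_gt y
  simpa only [causalKernel_one (sub_pos.2 hR), one_mul] using hy R

theorem ae_integrable_causalKernel_smul_reflected {μ b : ℝ} (hμ : 0 < μ) {u : ℝ → E}
    (hu : Integrable u) (hb : ∀ s, b < s → u s = 0) :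
    ∀ᵐ y, Integrable (fun s => causalKernel μ (s - y) • u s) := by
  have h := ae_integrable_causalKernel_smul hμ (b := -b) hu.comp_neg
    (fun s hs => hb _ (by linarith))
  have h' := (Measure.measurePreserving_neg (volume : Measure ℝ)).quasiMeasurePreserving.ae h
  filter_upwards [h'] with y hy
  have := hy.comp_neg
  simpa only [neg_neg, sub_neg_eq_add, neg_add_eq_sub] using this

end Convolution

section Sector

variable {E : Type*} [NormedAddCommGroup E] [InnerProductSpace ℝ E]

theorem ae_ne_prod : ∀ᵐ z : ℝ × ℝ, z.1 ≠ z.2 := by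
  rw [Measure.volume_eq_prod, Measure.ae_prod_iff_ae_ae]
  · filter_upwards with x
    have : ∀ᵐ y : ℝ, y ≠ x := by simp [ae_iff]
    filter_upwards [this] with y hy using hy.symm
  · exact (measurableSet_eq_fun measurable_fst measurable_snd).compl

/-- The form `∬ ω_μ(t - s) ⟨u(s), v(t)⟩` over `s < t`. -/
noncomputable def causalForm (μ : ℝ) (u v : ℝ → E) : ℝ :=
  ∫ z : ℝ × ℝ, causalKernel μ (z.2 - z.1) * inner ℝ (u z.1) (v z.2)

/-- Absolute convergence of `causalForm μ u v`. -/
def CausalFormIntegrable (μ : ℝ) (u v : ℝ → E) : Prop :=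
  Integrable fun z : ℝ × ℝ => causalKernel μ (z.2 - z.1) * inner ℝ (u z.1) (v z.2)

/-- Symmetrising the kernel doubles the quadratic form. -/
theorem integrable_and_integral_symm_causalForm {μ : ℝ} {u : ℝ → E}
    (h : CausalFormIntegrable μ u u) (c : ℝ) :
    Integrable (fun z : ℝ × ℝ => c * (causalKernel μ (z.2 - z.1) + causalKernel μ (z.1 - z.2)) *
      inner ℝ (u z.1) (u z.2)) ∧
    ∫ z : ℝ × ℝ, c * (causalKernel μ (z.2 - z.1) + causalKernel μ (z.1 - z.2)) *
      inner ℝ (u z.1) (u z.2) = 2 * c * causalForm μ u u := by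
  have hs : Integrable fun z : ℝ × ℝ =>
      causalKernel μ (z.1 - z.2) * inner ℝ (u z.1) (u z.2) := by
    have := Integrable.swap h
    rw [Measure.volume_eq_prod]
    simpa only [Function.comp_def, Prod.fst_swap, Prod.snd_swap, real_inner_comm] using this
  have hsi : ∫ z : ℝ × ℝ, causalKernel μ (z.1 - z.2) * inner ℝ (u z.1) (u z.2) =
      causalForm μ u u := by
    rw [causalForm, Measure.volume_eq_prod, ← integral_prod_swap]
    simp only [Prod.fst_swap, Prod.snd_swap, real_inner_comm]
  have e : ∀ z : ℝ × ℝ, c * (causalKernel μ (z.2 - z.1) + causalKernel μ (z.1 - z.2)) *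
      inner ℝ (u z.1) (u z.2) = c * (causalKernel μ (z.2 - z.1) * inner ℝ (u z.1) (u z.2)) +
        c * (causalKernel μ (z.1 - z.2) * inner ℝ (u z.1) (u z.2)) := by intro z; ring
  simp only [e]
  refine ⟨(Integrable.const_mul h c).add (hs.const_mul c), ?_⟩
  rw [integral_add (Integrable.const_mul h c) (hs.const_mul c), integral_const_mul,
    integral_const_mul, hsi, causalForm]
  ring

variable [CompleteSpace E] {a b T : ℝ} {g W : ℝ → E}

theorem measurable_uncurry_causalKernel_sub (μ : ℝ) :
    Measurable (Function.uncurry fun y s => causalKernel μ (y - s)) :=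
  (measurable_causalKernel μ).comp (by fun_prop)

theorem measurable_uncurry_causalKernel_sub_swap (μ : ℝ) :
    Measurable (Function.uncurry fun y s => causalKernel μ (s - y)) :=
  (measurable_causalKernel μ).comp (by fun_prop)

theorem integrable_and_integral_norm_sq_fracInt (ha : 0 < a) (ha' : a < 1 / 2)
    (hg : Integrable g) (hb : ∀ s, s < b → g s = 0) (hgg : CausalFormIntegrable (2 * a) g g) :
    Integrable (fun y => ‖∫ s, causalKernel a (y - s) • g s‖ ^ 2) ∧
    ∫ y, ‖∫ s, causalKernel a (y - s) • g s‖ ^ 2 =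
      (Real.cos (Real.pi * a))⁻¹ * causalForm (2 * a) g g := by
  have hgap : ∀ᵐ z : ℝ × ℝ, ∫ y, causalKernel a (y - z.1) * causalKernel a (y - z.2) =
      (2 * Real.cos (Real.pi * a))⁻¹ *
        (causalKernel (2 * a) (z.2 - z.1) + causalKernel (2 * a) (z.1 - z.2)) := by
    filter_upwards [ae_ne_prod] with z hz using integral_gap ha ha' hz
  have hsym := integrable_and_integral_symm_causalForm hgg (2 * Real.cos (Real.pi * a))⁻¹
  have hc := ae_integrable_causalKernel_smul ha hg hb
  have := integral_inner_integral_smul (measurable_uncurry_causalKernel_sub a)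
    (measurable_uncurry_causalKernel_sub a)
    (fun _ _ => causalKernel_nonneg ha _) (fun _ _ => causalKernel_nonneg ha _)
    hg.aestronglyMeasurable hg.aestronglyMeasurable
    (by filter_upwards [ae_ne_prod] with z hz using integrable_gap ha ha' hz)
    hgap hsym.1 hc hc
  simp only [real_inner_self_eq_norm_sq] at this
  refine ⟨this.1, this.2.trans (hsym.2.trans ?_)⟩
  rw [mul_inv]; ring

theorem integrable_and_integral_norm_sq_fracInt_reflected (ha : 0 < a) (ha' : a < 1 / 2)
    (hW : Integrable W) (hT : ∀ s, T < s → W s = 0)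
    (hWW : CausalFormIntegrable (2 * a) W W) :
    Integrable (fun y => ‖∫ s, causalKernel a (s - y) • W s‖ ^ 2) ∧
    ∫ y, ‖∫ s, causalKernel a (s - y) • W s‖ ^ 2 =
      (Real.cos (Real.pi * a))⁻¹ * causalForm (2 * a) W W := by
  have hgap : ∀ᵐ z : ℝ × ℝ, ∫ y, causalKernel a (z.1 - y) * causalKernel a (z.2 - y) =
      (2 * Real.cos (Real.pi * a))⁻¹ *
        (causalKernel (2 * a) (z.2 - z.1) + causalKernel (2 * a) (z.1 - z.2)) := by
    filter_upwards [ae_ne_prod] with z hz using integral_gap_reflected ha ha' hz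
  have hsym := integrable_and_integral_symm_causalForm hWW (2 * Real.cos (Real.pi * a))⁻¹
  have hc := ae_integrable_causalKernel_smul_reflected ha hW hT
  have := integral_inner_integral_smul (measurable_uncurry_causalKernel_sub_swap a)
    (measurable_uncurry_causalKernel_sub_swap a)
    (fun _ _ => causalKernel_nonneg ha _) (fun _ _ => causalKernel_nonneg ha _)
    hW.aestronglyMeasurable hW.aestronglyMeasurable
    (by filter_upwards [ae_ne_prod] with z hz using integrable_gap_reflected ha ha' hz)
    hgap hsym.1 hc hc
  simp only [real_inner_self_eq_norm_sq] at this
  refine ⟨this.1, this.2.trans (hsym.2.trans ?_)⟩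
  rw [mul_inv]; ring

/-- Factorisation of `I^{2a}` through `I^a`: the mixed form is the `L₂(ℝ)` pairing of the causal
fractional integral of `g` with the anticausal one of `W`. -/
theorem integrable_and_integral_inner_fracInt (ha : 0 < a)
    (hg : Integrable g) (hb : ∀ s, s < b → g s = 0)
    (hW : Integrable W) (hT : ∀ s, T < s → W s = 0) (hgW : CausalFormIntegrable (2 * a) g W) :
    Integrable (fun y => inner ℝ (∫ s, causalKernel a (y - s) • g s)
      (∫ s, causalKernel a (s - y) • W s)) ∧
    ∫ y, inner ℝ (∫ s, causalKernel a (y - s) • g s) (∫ s, causalKernel a (s - y) • W s) =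
      causalForm (2 * a) g W := by
  refine integral_inner_integral_smul (m := fun z => causalKernel (2 * a) (z.2 - z.1))
    (measurable_uncurry_causalKernel_sub a) (measurable_uncurry_causalKernel_sub_swap a)
    (fun _ _ => causalKernel_nonneg ha _) (fun _ _ => causalKernel_nonneg ha _)
    hg.aestronglyMeasurable hW.aestronglyMeasurable ?_ ?_ hgW
    (ae_integrable_causalKernel_smul ha hg hb) (ae_integrable_causalKernel_smul_reflected ha hW hT)
  · filter_upwards with z
    simpa only [mul_comm] using integrable_causalKernel_mul ha ha z.1 z.2
  · filter_upwards with z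
    rw [two_mul, ← integral_causalKernel_mul ha ha z.1 z.2]
    simp only [mul_comm]

/-- **Sector inequality**: Young's inequality for the non-symmetric form `causalForm (2a)`, whose
Fourier symbol `(iξ)^(-2a)` lies on the boundary of the sector of half-angle `πa`. The factor
`1 / cos(πa)` enters once through the half-integral of `g` and once through that of `W`. -/
theorem two_mul_causalForm_le (ha : 0 < a) (ha' : a < 1 / 2)
    (hg : Integrable g) (hb : ∀ s, s < b → g s = 0)
    (hW : Integrable W) (hT : ∀ s, T < s → W s = 0)
    (hgg : CausalFormIntegrable (2 * a) g g) (hgW : CausalFormIntegrable (2 * a) g W)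
    (hWW : CausalFormIntegrable (2 * a) W W) {r : ℝ} (hr : 0 < r) :
    2 * causalForm (2 * a) g W ≤ r * causalForm (2 * a) g g +
      (Real.cos (Real.pi * a))⁻¹ ^ 2 / r * causalForm (2 * a) W W := by
  have hc : 0 < Real.cos (Real.pi * a) :=
    Real.cos_pos_of_mem_Ioo ⟨by nlinarith [Real.pi_pos], by nlinarith [Real.pi_pos]⟩
  obtain ⟨i1, e1⟩ := integrable_and_integral_norm_sq_fracInt ha ha' hg hb hgg
  obtain ⟨i2, e2⟩ := integrable_and_integral_norm_sq_fracInt_reflected ha ha' hW hT hWW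
  obtain ⟨i3, e3⟩ := integrable_and_integral_inner_fracInt ha hg hb hW hT hgW
  set c := Real.cos (Real.pi * a)
  have hmono := integral_mono (i3.const_mul 2) ((i1.const_mul (r * c)).add
    (i2.const_mul (r * c)⁻¹)) (fun y => by
      simp only [Pi.add_apply]
      set p := ∫ s, causalKernel a (y - s) • g s
      set q := ∫ s, causalKernel a (s - y) • W s
      have h1 : inner ℝ p q ≤ ‖p‖ * ‖q‖ := real_inner_le_norm p q
      have hrc : 0 < r * c := by positivity
      have h2 : r * c * ‖p‖ ^ 2 + (r * c)⁻¹ * ‖q‖ ^ 2 - 2 * (‖p‖ * ‖q‖) =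
          (r * c)⁻¹ * (r * c * ‖p‖ - ‖q‖) ^ 2 := by field_simp; ring
      have h3 : 0 ≤ (r * c)⁻¹ * (r * c * ‖p‖ - ‖q‖) ^ 2 := by positivity
      linarith)
  simp only [Pi.add_apply] at hmono
  rw [integral_const_mul, integral_add (i1.const_mul _) (i2.const_mul _), integral_const_mul,
    integral_const_mul, e1, e2, e3] at hmono
  refine hmono.trans (le_of_eq ?_)
  field_simp

end Sector

/-! ### Fractional calculus of truncated powers -/

section FracInt

variable {E : Type*} [NormedAddCommGroup E] [NormedSpace ℝ E]

theorem fracInt_eq_integral_causalKernel (μ : ℝ) {t : ℝ} (ht : 0 ≤ t) {v w : ℝ → E}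
    (hw : ∀ s, s ≤ 0 → w s = 0) (hvw : ∀ᵐ s, s ∈ Ioo 0 t → v s = w s) :
    fracInt μ v t = ∫ s, causalKernel μ (t - s) • w s := by
  have hsupp : ∀ s, s ∉ Ioo 0 t → causalKernel μ (t - s) • w s = 0 := by
    intro s hs
    rcases le_or_gt s 0 with h | h
    · rw [hw s h, smul_zero]
    · rw [causalKernel_of_nonpos, zero_smul]
      by_contra h'
      exact hs ⟨h, by linarith⟩
  rw [fracInt, intervalIntegral.integral_of_le ht, integral_Ioc_eq_integral_Ioo,
    ← setIntegral_eq_integral_of_forall_compl_eq_zero hsupp]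
  refine setIntegral_congr_ae measurableSet_Ioo ?_
  filter_upwards [hvw] with s hs hs'
  rw [hs hs', causalKernel_of_pos (by linarith [hs'.2]), omega]

end FracInt

section CausalForm

variable {E : Type*} [NormedAddCommGroup E] [InnerProductSpace ℝ E] [CompleteSpace E]

/-- By Fubini's theorem the form is the `L₂` pairing of `I^μ u` with `v`. -/
theorem CausalFormIntegrable.integrable_and_eq_integral {μ : ℝ} {u v : ℝ → E}
    (h : CausalFormIntegrable μ u v)
    (hu : ∀ᵐ t, Integrable (fun s => causalKernel μ (t - s) • u s)) :
    Integrable (fun t => inner ℝ (∫ s, causalKernel μ (t - s) • u s) (v t)) ∧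
    causalForm μ u v = ∫ t, inner ℝ (∫ s, causalKernel μ (t - s) • u s) (v t) := by
  have key : ∀ᵐ t, ∫ s, causalKernel μ (t - s) * inner ℝ (u s) (v t) =
      inner ℝ (∫ s, causalKernel μ (t - s) • u s) (v t) := by
    filter_upwards [hu] with t ht
    rw [real_inner_comm, ← integral_inner ht (v t)]
    refine integral_congr_ae (Filter.Eventually.of_forall fun s => ?_)
    simp only [real_inner_smul_right, real_inner_comm]
  unfold CausalFormIntegrable at h
  unfold causalForm
  rw [Measure.volume_eq_prod] at h ⊢
  exact ⟨h.integral_prod_right.congr key, by rw [integral_prod_symm _ h, integral_congr_ae key]⟩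

end CausalForm

section KernelSum

variable {ι : Type*} {E : Type*} [NormedAddCommGroup E] [NormedSpace ℝ E]

/-- The truncated power function `∑ᵢ ω_{mᵢ}((t - aᵢ)₊) cᵢ`, with exponents `mᵢ - 1` and starting
points `aᵢ`. Fractional integrals and derivatives only shift the exponents. -/
noncomputable def kernelSum (S : Finset ι) (m a : ι → ℝ) (c : ι → E) (t : ℝ) : E :=
  ∑ i ∈ S, causalKernel (m i) (t - a i) • c i

variable {S : Finset ι} {m a : ι → ℝ} {c : ι → E}

theorem kernelSum_of_nonpos (ha : ∀ i ∈ S, 0 ≤ a i) {t : ℝ} (ht : t ≤ 0) :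
    kernelSum S m a c t = 0 := by
  refine Finset.sum_eq_zero fun i hi => ?_
  rw [causalKernel_of_nonpos (by linarith [ha i hi]), zero_smul]

theorem stronglyMeasurable_kernelSum : StronglyMeasurable (kernelSum S m a c) := by
  unfold kernelSum
  refine Finset.stronglyMeasurable_fun_sum _ fun i _ => ?_
  have h : Measurable fun t : ℝ => causalKernel (m i) (t - a i) :=
    (measurable_causalKernel _).comp (by fun_prop)
  exact h.stronglyMeasurable.smul_const _

theorem norm_kernelSum_le (hm : ∀ i ∈ S, 0 < m i) (t : ℝ) :
    ‖kernelSum S m a c t‖ ≤ kernelSum S m a (fun i => ‖c i‖) t := by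
  refine (norm_sum_le _ _).trans (le_of_eq (Finset.sum_congr rfl fun i hi => ?_))
  rw [norm_smul, Real.norm_of_nonneg (causalKernel_nonneg (hm i hi) _), smul_eq_mul]

theorem kernelSum_mono {c : ι → ℝ} (hc : ∀ i ∈ S, 0 ≤ c i) (hm : ∀ i ∈ S, 1 ≤ m i) :
    Monotone (kernelSum S m a c) := by
  intro s t hst
  refine Finset.sum_le_sum fun i hi => ?_
  exact mul_le_mul_of_nonneg_right (causalKernel_mono (hm i hi) (by linarith)) (hc i hi)

theorem integrable_causalKernel_smul_kernelSum {μ : ℝ} (hμ : 0 < μ) (hm : ∀ i ∈ S, 0 < m i)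
    (t : ℝ) : Integrable fun s => causalKernel μ (t - s) • kernelSum S m a c s := by
  unfold kernelSum
  simp only [Finset.smul_sum, smul_smul]
  exact integrable_finsetSum _ fun i hi =>
    (integrable_causalKernel_mul hμ (hm i hi) (a i) t).smul_const _

theorem integral_causalKernel_smul_kernelSum [CompleteSpace E] {μ : ℝ} (hμ : 0 < μ)
    (hm : ∀ i ∈ S, 0 < m i) (t : ℝ) :
    ∫ s, causalKernel μ (t - s) • kernelSum S m a c s =
      kernelSum S (fun i => m i + μ) a c t := by
  unfold kernelSum
  simp only [Finset.smul_sum, smul_smul]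
  rw [integral_finsetSum _ fun i hi =>
    (integrable_causalKernel_mul hμ (hm i hi) (a i) t).smul_const _]
  refine Finset.sum_congr rfl fun i hi => ?_
  rw [integral_smul_const, integral_causalKernel_mul hμ (hm i hi), add_comm μ]

theorem hasDerivAt_causalKernel_add_one {μ x : ℝ} (hμ : 0 < μ) (hx : x ≠ 0) :
    HasDerivAt (causalKernel (μ + 1)) (causalKernel μ x) x := by
  rcases lt_or_gt_of_ne hx with h | h
  · rw [causalKernel_of_nonpos h.le]
    refine (hasDerivAt_const x (0 : ℝ)).congr_of_eventuallyEq ?_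
    filter_upwards [Iio_mem_nhds h] with y hy using causalKernel_of_nonpos (le_of_lt hy)
  · have h1 := (Real.hasDerivAt_rpow_const (x := x) (p := μ) (Or.inl hx)).div_const
      (Real.Gamma (μ + 1))
    have e : μ * x ^ (μ - 1) / Real.Gamma (μ + 1) = causalKernel μ x := by
      rw [causalKernel_of_pos h, Real.Gamma_add_one hμ.ne']
      field_simp
    rw [e] at h1
    refine h1.congr_of_eventuallyEq ?_
    filter_upwards [Ioi_mem_nhds h] with y hy
    rw [causalKernel_of_pos hy, add_sub_cancel_right]

theorem hasDerivAt_kernelSum_add_one (hm : ∀ i ∈ S, 0 < m i) {t : ℝ} (ht : ∀ i ∈ S, t ≠ a i) :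
    HasDerivAt (kernelSum S (fun i => m i + 1) a c) (kernelSum S m a c t) t := by
  unfold kernelSum
  refine HasDerivAt.fun_sum fun i hi => HasDerivAt.smul_const ?_ _
  have := (hasDerivAt_causalKernel_add_one (hm i hi) (sub_ne_zero.2 (ht i hi)))
  exact this.comp_sub_const t (a i)

/-- The Riemann–Liouville derivative of a truncated power function. -/
theorem fracDeriv_eq_kernelSum [CompleteSpace E] {α b t : ℝ} (hα : -1 < α)
    (hm : ∀ i ∈ S, 0 < m i + α) (hm' : ∀ i ∈ S, 0 < m i) (ha : ∀ i ∈ S, 0 ≤ a i)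
    {v : ℝ → E} (hv : ∀ᵐ s, s ∈ Ioo 0 b → v s = kernelSum S m a c s)
    (ht : t ∈ Ioo 0 b) (hta : ∀ i ∈ S, t ≠ a i) :
    fracDeriv α v t = kernelSum S (fun i => m i + α) a c t := by
  have h := hasDerivAt_kernelSum_add_one (c := c) hm hta
  refine (h.congr_of_eventuallyEq ?_).deriv
  filter_upwards [Ioo_mem_nhds ht.1 ht.2] with r hr
  rw [fracInt_eq_integral_causalKernel (α + 1) hr.1.le
      (fun s hs => kernelSum_of_nonpos ha hs) (by
      filter_upwards [hv] with s hs hs'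
      exact hs ⟨hs'.1, hs'.2.trans hr.2⟩),
    integral_causalKernel_smul_kernelSum (by linarith) hm']
  simp only [add_assoc]

theorem integrableOn_kernelSum (hm : ∀ i ∈ S, 0 < m i) (R : ℝ) :
    IntegrableOn (kernelSum S m a c) (Iio R) := by
  have h := integrable_causalKernel_smul_kernelSum (c := c) (a := a) one_pos hm R
  refine h.integrableOn.congr_fun (fun s hs => ?_) measurableSet_Iio
  simp only
  rw [causalKernel_one (sub_pos.2 hs), one_smul]

end KernelSum

section FormIntegrable

variable {ι : Type*} {E : Type*} [NormedAddCommGroup E] [InnerProductSpace ℝ E]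
  {S : Finset ι} {m a : ι → ℝ} {c : ι → E}

/-- If `I^μ` of a truncated power function is bounded, then its mixed form with any integrable
function converges absolutely. -/
theorem causalFormIntegrable_kernelSum {μ b : ℝ} (hμ : 0 < μ) (hm : ∀ i ∈ S, 0 < m i)
    (hmμ : ∀ i ∈ S, 1 ≤ m i + μ) {W : ℝ → E} (hW : Integrable W) (hb : ∀ s, b < s → W s = 0) :
    CausalFormIntegrable μ ((Ioo 0 b).indicator (kernelSum S m a c)) W := by
  have hgm : StronglyMeasurable ((Ioo 0 b).indicator (kernelSum S m a c)) :=
    stronglyMeasurable_kernelSum.indicator measurableSet_Ioo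
  have hgn : ∀ s, ‖(Ioo 0 b).indicator (kernelSum S m a c) s‖ ≤
      kernelSum S m a (fun i => ‖c i‖) s := fun s =>
    (norm_indicator_le_norm_self _ _).trans (norm_kernelSum_le hm s)
  set g := (Ioo 0 b).indicator (kernelSum S m a c)
  set h := kernelSum S m a (fun i => ‖c i‖)
  have hκ : Measurable fun p : ℝ × ℝ => causalKernel μ (p.2 - p.1) :=
    (measurable_causalKernel μ).comp (by fun_prop)
  have hi := fun t => integrable_causalKernel_smul_kernelSum (S := S) (m := m) (a := a)
    (c := fun i => ‖c i‖) hμ hm t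
  -- The form is dominated by the same form of scalar functions, which Tonelli's theorem handles.
  have hdom : Integrable (fun p : ℝ × ℝ => (causalKernel μ (p.2 - p.1) * h p.1) * ‖W p.2‖)
      (volume.prod volume) := by
    have hFm : AEStronglyMeasurable
        (fun p : ℝ × ℝ => (causalKernel μ (p.2 - p.1) * h p.1) * ‖W p.2‖)
        (volume.prod volume) :=
      (hκ.aestronglyMeasurable.mul
        (stronglyMeasurable_kernelSum.comp_measurable measurable_fst).aestronglyMeasurable).mul
        hW.aestronglyMeasurable.comp_snd.norm
    rw [integrable_prod_iff' hFm]
    constructor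
    · filter_upwards with t
      exact (hi t).mul_const _
    · have hnn : ∀ s, 0 ≤ h s := fun s => (norm_nonneg _).trans (hgn s)
      have e : ∀ t, ∫ s, ‖causalKernel μ (t - s) * h s * ‖W t‖‖ =
          kernelSum S (fun i => m i + μ) a (fun i => ‖c i‖) t * ‖W t‖ := by
        intro t
        rw [← integral_causalKernel_smul_kernelSum hμ hm t, ← integral_mul_const]
        refine integral_congr_ae (Filter.Eventually.of_forall fun s => ?_)
        simp only [smul_eq_mul]
        exact Real.norm_of_nonneg (mul_nonneg (mul_nonneg (causalKernel_nonneg hμ _) (hnn s))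
          (norm_nonneg _))
      simp only [e]
      refine (hW.norm.const_mul (kernelSum S (fun i => m i + μ) a (fun i => ‖c i‖) b)).mono'
        (stronglyMeasurable_kernelSum.aestronglyMeasurable.mul hW.aestronglyMeasurable.norm)
        (Filter.Eventually.of_forall fun t => ?_)
      rcases lt_or_ge b t with ht | ht
      · simp [hb t ht]
      · have h0 : 0 ≤ kernelSum S (fun i => m i + μ) a (fun i => ‖c i‖) t :=
          Finset.sum_nonneg fun i hi => mul_nonneg
            (causalKernel_nonneg (by linarith [hmμ i hi]) _) (norm_nonneg _)
        rw [Real.norm_of_nonneg (mul_nonneg h0 (norm_nonneg _))]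
        gcongr
        exact kernelSum_mono (fun i _ => norm_nonneg _) hmμ ht
  refine hdom.mono' ?_ (Filter.Eventually.of_forall fun p => ?_)
  · exact hκ.aestronglyMeasurable.mul
      ((hgm.comp_measurable measurable_fst).aestronglyMeasurable.inner
        hW.aestronglyMeasurable.comp_snd)
  · rw [norm_mul, Real.norm_of_nonneg (causalKernel_nonneg hμ _), mul_assoc]
    refine mul_le_mul_of_nonneg_left ?_ (causalKernel_nonneg hμ _)
    exact (norm_inner_le_norm _ _).trans (mul_le_mul_of_nonneg_right (hgn _) (norm_nonneg _))

end FormIntegrable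

/-! ### The Poincaré inequality and the solution operator `A⁻¹` -/

section Poincare

variable {d : ℕ}

/-- The **Poincaré inequality** for a test function supported in a ball of radius `R`. Integrating
`φ² = φ² ∂₁x₁` by parts gives `∫ φ² = -2 ∫ x₁ φ ∂₁φ`, to which Young's inequality is applied. -/
theorem integral_sq_le_integral_norm_fderiv_sq (hd : 1 ≤ d)
    {φ : EuclideanSpace ℝ (Fin d) → ℝ} (hφ : ContDiff ℝ ∞ φ) (hc : HasCompactSupport φ) {R : ℝ}
    (hR : ∀ x ∈ tsupport φ, ‖x‖ ≤ R) :
    ∫ x, φ x ^ 2 ≤ 4 * R ^ 2 * ∫ x, ‖fderiv ℝ φ x‖ ^ 2 := by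
  let i : Fin d := ⟨0, hd⟩
  let e : EuclideanSpace ℝ (Fin d) := EuclideanSpace.single i 1
  let ℓ : EuclideanSpace ℝ (Fin d) →L[ℝ] ℝ := EuclideanSpace.proj i
  have hℓe : ℓ e = 1 := by simp [ℓ, e]
  have hdiff : Differentiable ℝ φ := hφ.differentiable (by simp)
  have hcont : Continuous φ := hφ.continuous
  have hcont' : Continuous (fderiv ℝ φ) := hφ.continuous_fderiv (by simp)
  have hc' : HasCompactSupport (fderiv ℝ φ) := hc.fderiv ℝ
  have hder : ∀ x, fderiv ℝ (fun x => φ x ^ 2) x e = 2 * φ x * fderiv ℝ φ x e := by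
    intro x
    rw [((hdiff x).hasFDerivAt.pow 2).fderiv]
    simp
  have i1 : Integrable fun x => φ x ^ 2 :=
    (hcont.pow 2).integrable_of_hasCompactSupport (by
      simpa only [pow_two] using hc.mul_left (f := φ))
  have i2 : Integrable fun x => ‖fderiv ℝ φ x‖ ^ 2 :=
    (hcont'.norm.pow 2).integrable_of_hasCompactSupport (by
      simpa only [pow_two] using hc'.norm.mul_left (f := fun x => ‖fderiv ℝ φ x‖))
  have i3 : Integrable fun x => fderiv ℝ (fun x => φ x ^ 2) x e * ℓ x := by
    simp only [hder]
    refine Continuous.integrable_of_hasCompactSupport (by fun_prop) ?_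
    exact ((hc.mul_left (f := fun _ => (2 : ℝ))).mul_right).mul_right
  have i4 : Integrable fun x => φ x ^ 2 * ℓ x := by
    refine Continuous.integrable_of_hasCompactSupport (by fun_prop) ?_
    simp only [pow_two]
    exact (hc.mul_right (f' := φ)).mul_right
  have hparts := integral_mul_fderiv_eq_neg_fderiv_mul_of_integrable (f := fun x => φ x ^ 2)
    (g := fun x => ℓ x) (v := e) i3 (by simpa [hℓe] using i1) i4
    (fun x _ => ((hdiff x).pow 2)) (fun x _ => ℓ.differentiableAt)
  have hfe : ∀ x, fderiv ℝ (fun x => ℓ x) x e = 1 := fun x => by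
    rw [show (fun x => ℓ x) = ⇑ℓ from rfl, ℓ.fderiv, hℓe]
  simp only [hfe, mul_one] at hparts
  have hpt : ∀ x, -(fderiv ℝ (fun x => φ x ^ 2) x e * ℓ x) ≤
      1 / 2 * φ x ^ 2 + 2 * R ^ 2 * ‖fderiv ℝ φ x‖ ^ 2 := by
    intro x
    rw [hder]
    by_cases hx : x ∈ tsupport φ
    · have h1 : |ℓ x| ≤ R := by
        have : ‖x i‖ ≤ ‖x‖ := PiLp.norm_apply_le x i
        exact this.trans (hR x hx)
      have h2 : |fderiv ℝ φ x e| ≤ ‖fderiv ℝ φ x‖ := by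
        have := (fderiv ℝ φ x).le_opNorm e
        simpa [e] using this
      have h3 : |ℓ x * fderiv ℝ φ x e| ≤ R * ‖fderiv ℝ φ x‖ := by
        rw [abs_mul]
        exact mul_le_mul h1 h2 (abs_nonneg _) ((abs_nonneg _).trans h1)
      have h4 : (ℓ x * fderiv ℝ φ x e) ^ 2 ≤ (R * ‖fderiv ℝ φ x‖) ^ 2 := by
        rw [← sq_abs]
        exact pow_le_pow_left₀ (abs_nonneg _) h3 2
      nlinarith [sq_nonneg (φ x + 2 * (ℓ x * fderiv ℝ φ x e))]
    · rw [image_eq_zero_of_notMem_tsupport hx]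
      have : 0 ≤ 2 * R ^ 2 * ‖fderiv ℝ φ x‖ ^ 2 := by positivity
      simpa using this
  have hle := integral_mono i3.neg ((i1.const_mul (1 / 2)).add (i2.const_mul (2 * R ^ 2))) hpt
  simp only [Pi.neg_apply, Pi.add_apply] at hle
  rw [integral_neg, ← hparts, integral_add (i1.const_mul (1 / 2)) (i2.const_mul (2 * R ^ 2)),
    integral_const_mul, integral_const_mul] at hle
  linarith

variable {Ω : Set (EuclideanSpace ℝ (Fin d))}

theorem norm_sq_eq_setIntegral {F : Type*} [NormedAddCommGroup F] [InnerProductSpace ℝ F]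
    {w : Lp F 2 (volume.restrict Ω)} {φ : EuclideanSpace ℝ (Fin d) → F}
    (h : w =ᵐ[volume.restrict Ω] φ) : ‖w‖ ^ 2 = ∫ x in Ω, ‖φ x‖ ^ 2 := by
  rw [← real_inner_self_eq_norm_sq, L2.inner_def]
  refine integral_congr_ae ?_
  filter_upwards [h] with x hx
  rw [hx, real_inner_self_eq_norm_sq]

theorem norm_fst_sq_le_of_mem_testPairs (hd : 1 ≤ d) {R : ℝ} (hR : ∀ x ∈ Ω, ‖x‖ ≤ R)
    {w : WithLp 2 (L2 Ω × L2Vec Ω)} (hw : w ∈ testPairs Ω) :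
    ‖w.fst‖ ^ 2 ≤ 4 * R ^ 2 * ‖w.snd‖ ^ 2 := by
  obtain ⟨φ, hφ, hc, hs, h1, h2⟩ := hw
  have hg : ∀ x, ‖∇ φ x‖ = ‖fderiv ℝ φ x‖ := fun x => by simp [gradient]
  rw [norm_sq_eq_setIntegral h1, norm_sq_eq_setIntegral h2]
  simp only [hg, Real.norm_eq_abs, sq_abs]
  rw [setIntegral_eq_integral_of_forall_compl_eq_zero,
    setIntegral_eq_integral_of_forall_compl_eq_zero]
  · exact integral_sq_le_integral_norm_fderiv_sq hd hφ hc fun x hx => hR x (hs hx)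
  · intro x hx
    have : x ∉ tsupport (fderiv ℝ φ) := fun h => hx (hs (tsupport_fderiv_subset ℝ h))
    simp [image_eq_zero_of_notMem_tsupport this]
  · intro x hx
    simp [image_eq_zero_of_notMem_tsupport fun h => hx (hs h)]

/-- The embedding `H¹₀(Ω) → L₂(Ω)` as a continuous linear map. -/
noncomputable def toL2L (Ω : Set (EuclideanSpace ℝ (Fin d))) : H10 Ω →L[ℝ] L2 Ω :=
  WithLp.fstL 2 ℝ (L2 Ω) (L2Vec Ω) ∘L (H10 Ω).subtypeL

/-- The weak gradient on `H¹₀(Ω)` as a continuous linear map. -/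
noncomputable def gradL (Ω : Set (EuclideanSpace ℝ (Fin d))) : H10 Ω →L[ℝ] L2Vec Ω :=
  WithLp.sndL 2 ℝ (L2 Ω) (L2Vec Ω) ∘L (H10 Ω).subtypeL

theorem toL2L_apply (v : H10 Ω) : toL2L Ω v = toL2 v := rfl

theorem gradL_apply (v : H10 Ω) : gradL Ω v = grad v := rfl

theorem norm_toL2_sq_le (hd : 1 ≤ d) {R : ℝ} (hR : ∀ x ∈ Ω, ‖x‖ ≤ R) (v : H10 Ω) :
    ‖toL2 v‖ ^ 2 ≤ 4 * R ^ 2 * ‖grad v‖ ^ 2 := by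
  have hcl : IsClosed {w : WithLp 2 (L2 Ω × L2Vec Ω) |
      ‖w.fst‖ ^ 2 ≤ 4 * R ^ 2 * ‖w.snd‖ ^ 2} := by
    have c1 : Continuous fun w : WithLp 2 (L2 Ω × L2Vec Ω) => w.fst :=
      (WithLp.fstL 2 ℝ (L2 Ω) (L2Vec Ω)).continuous
    have c2 : Continuous fun w : WithLp 2 (L2 Ω × L2Vec Ω) => w.snd :=
      (WithLp.sndL 2 ℝ (L2 Ω) (L2Vec Ω)).continuous
    exact isClosed_le (by fun_prop) (by fun_prop)
  have hsub : ((testPairs Ω).topologicalClosure : Set (WithLp 2 (L2 Ω × L2Vec Ω))) ⊆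
      {w | ‖w.fst‖ ^ 2 ≤ 4 * R ^ 2 * ‖w.snd‖ ^ 2} :=
    closure_minimal (fun w hw => norm_fst_sq_le_of_mem_testPairs hd hR hw) hcl
  exact hsub v.2

/-- `A(·,·)` as a bounded bilinear form on `H¹₀(Ω)`. -/
noncomputable def bilinAL (Ω : Set (EuclideanSpace ℝ (Fin d))) (K : ℝ) :
    H10 Ω →L[ℝ] H10 Ω →L[ℝ] ℝ :=
  K • (innerSL ℝ).bilinearComp (gradL Ω) (gradL Ω)

theorem bilinAL_apply (K : ℝ) (v w : H10 Ω) : bilinAL Ω K v w = bilinA K v w := rfl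

theorem isCoercive_bilinAL (hd : 1 ≤ d) (hΩ : Bornology.IsBounded Ω) {K : ℝ} (hK : 0 < K) :
    IsCoercive (bilinAL Ω K) := by
  obtain ⟨R, hR⟩ := hΩ.exists_norm_le
  refine ⟨K / (4 * R ^ 2 + 1), by positivity, fun v => ?_⟩
  have h1 := norm_toL2_sq_le hd hR v
  have h2 : ‖v‖ ^ 2 = ‖toL2 v‖ ^ 2 + ‖grad v‖ ^ 2 :=
    WithLp.prod_norm_sq_eq_of_L2 (v : WithLp 2 (L2 Ω × L2Vec Ω))
  rw [bilinAL_apply, bilinA, real_inner_self_eq_norm_sq, mul_assoc, ← pow_two, h2,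
    div_mul_eq_mul_div, div_le_iff₀ (by positivity)]
  nlinarith

/-- By the Lax–Milgram theorem `A⁻¹` is a bounded linear operator `L₂(Ω) → H¹₀(Ω)`. -/
theorem exists_invA_eq (hd : 1 ≤ d) (hΩ : Bornology.IsBounded Ω) {K : ℝ} (hK : 0 < K) :
    ∃ S : L2 Ω →L[ℝ] H10 Ω, ∀ F, SolvesA K F (S F) ∧ invA K F = S F := by
  have hB := isCoercive_bilinAL hd hΩ hK
  let e := hB.continuousLinearEquivOfBilin
  let S : L2 Ω →L[ℝ] H10 Ω := (e.symm : H10 Ω →L[ℝ] H10 Ω) ∘L (toL2L Ω).adjoint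
  have hS : ∀ F, SolvesA K F (S F) := by
    intro F v
    have h := hB.continuousLinearEquivOfBilin_apply (S F) v
    rw [← bilinAL_apply, ← h]
    change inner ℝ (e (e.symm ((toL2L Ω).adjoint F))) v = _
    rw [e.apply_symm_apply, ContinuousLinearMap.adjoint_inner_left, toL2L_apply]
  refine ⟨S, fun F => ⟨hS F, ?_⟩⟩
  have hex : ∃ w : H10 Ω, SolvesA K F w := ⟨S F, hS F⟩
  have hinv : invA K F = hex.choose := by rw [invA, dif_pos hex]
  have hsol : SolvesA K F (invA K F) := hinv ▸ hex.choose_spec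
  have hzero : ∀ v, bilinAL Ω K (invA K F - S F) v = 0 := by
    intro v
    rw [map_sub, sub_apply, bilinAL_apply, bilinAL_apply, hsol, hS, sub_self]
  obtain ⟨C, hC, hcoer⟩ := hB
  have h1 := hcoer (invA K F - S F)
  rw [hzero, mul_assoc] at h1
  have h2 : ‖invA K F - S F‖ * ‖invA K F - S F‖ ≤ 0 := by
    by_contra! h
    exact absurd h1 (mul_pos hC h).not_ge
  rw [← sub_eq_zero, ← norm_eq_zero]
  nlinarith [norm_nonneg (invA K F - S F)]

end Poincare

/-! ### Piecewise polynomials as truncated powers -/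

section Poly

variable {E : Type*} [AddCommGroup E] [Module ℝ E]

theorem IsPoly.mono {q r : ℕ} (hqr : q ≤ r) {X : ℝ → E} (h : IsPoly q X) : IsPoly r X := by
  obtain ⟨c, hc⟩ := h
  refine ⟨fun i => if i < q + 1 then c i else 0, fun t => ?_⟩
  rw [hc t, ← Finset.sum_subset (Finset.range_subset_range.2 (show q + 1 ≤ r + 1 by lia))]
  · exact Finset.sum_congr rfl fun i hi => by
      beta_reduce
      rw [if_pos (Finset.mem_range.1 hi)]
  · intro i _ hi
    beta_reduce
    rw [if_neg (by simpa using hi), smul_zero]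

theorem IsPoly.sub {q : ℕ} {X Y : ℝ → E} (hX : IsPoly q X) (hY : IsPoly q Y) :
    IsPoly q (fun t => X t - Y t) := by
  obtain ⟨c, hc⟩ := hX
  obtain ⟨c', hc'⟩ := hY
  exact ⟨fun i => c i - c' i, fun t => by simp only [hc, hc', smul_sub, Finset.sum_sub_distrib]⟩

theorem IsPoly.zero (q : ℕ) : IsPoly q (fun _ => (0 : E)) := ⟨fun _ => 0, by simp⟩

/-- Re-expansion of a polynomial about the point `a`. -/
theorem IsPoly.exists_eq_sum_sub_pow {q : ℕ} {X : ℝ → E} (h : IsPoly q X) (a : ℝ) :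
    ∃ c : ℕ → E, ∀ t, X t = ∑ i ∈ Finset.range (q + 1), (t - a) ^ i • c i := by
  obtain ⟨c, hc⟩ := h
  refine ⟨fun j => ∑ i ∈ Finset.range (q + 1), (a ^ (i - j) * (i.choose j : ℝ)) • c i,
    fun t => ?_⟩
  have hb : ∀ i ∈ Finset.range (q + 1), t ^ i =
      ∑ j ∈ Finset.range (q + 1), (t - a) ^ j * (a ^ (i - j) * (i.choose j : ℝ)) := by
    intro i hi
    have h1 := add_pow (t - a) a i
    rw [sub_add_cancel] at h1
    rw [h1, ← Finset.sum_subset (Finset.range_subset_range.2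
      (show i + 1 ≤ q + 1 from Finset.mem_range.1 hi))]
    · exact Finset.sum_congr rfl fun j _ => by ring
    · intro j _ hj
      rw [Nat.choose_eq_zero_of_lt (by simpa using hj)]
      simp
  rw [hc t]
  simp only [Finset.smul_sum, smul_smul]
  rw [Finset.sum_comm]
  refine Finset.sum_congr rfl fun i hi => ?_
  rw [hb i hi, Finset.sum_smul]

end Poly

theorem IsPoly.contDiff {E : Type*} [NormedAddCommGroup E] [NormedSpace ℝ E] {q : ℕ} {X : ℝ → E}
    (h : IsPoly q X) : ContDiff ℝ ∞ X := by
  obtain ⟨c, hc⟩ := h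
  rw [show X = fun t => ∑ i ∈ Finset.range (q + 1), t ^ i • c i from funext hc]
  exact ContDiff.sum fun i _ => (contDiff_id.pow i).smul contDiff_const

section Mesh

variable {T : ℝ} (M : TimeMesh T)

theorem TimeMesh.t_le {i j : ℕ} (hij : i ≤ j) (hj : j ≤ M.N) : M.t i ≤ M.t j := by
  induction j, hij using Nat.le_induction with
  | base => exact le_rfl
  | succ j hij ih => exact (ih (by lia)).trans (M.t_lt (j + 1) (by lia) hj).le

theorem TimeMesh.t_nonneg {j : ℕ} (hj : j ≤ M.N) : 0 ≤ M.t j :=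
  M.t_zero ▸ M.t_le (Nat.zero_le j) hj

theorem TimeMesh.exists_mem_Ioo {n : ℕ} (hn : n ≤ M.N) {t : ℝ} (ht : t ∈ Ioo 0 (M.t n))
    (htM : t ∉ range M.t) : ∃ l, l < n ∧ t ∈ Ioo (M.t l) (M.t (l + 1)) := by
  induction n with
  | zero =>
    rw [M.t_zero] at ht
    exact absurd (ht.1.trans ht.2) (lt_irrefl _)
  | succ n ih =>
    rcases lt_trichotomy t (M.t n) with h | h | h
    · obtain ⟨l, hl, hl'⟩ := ih (by lia) ⟨ht.1, h⟩
      exact ⟨l, by lia, hl'⟩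
    · exact absurd ⟨n, h.symm⟩ htM
    · exact ⟨n, by lia, h, ht.2⟩

theorem TimeMesh.ae_notMem_range : ∀ᵐ t : ℝ, t ∉ range M.t :=
  (countable_range M.t).ae_notMem volume

end Mesh

theorem causalKernel_natCast_add_one (k : ℕ) {x : ℝ} (hx : 0 < x) :
    causalKernel (k + 1) x = x ^ k / Real.Gamma (k + 1) := by
  rw [causalKernel_of_pos hx, add_sub_cancel_right, Real.rpow_natCast]

/-- A piecewise polynomial is, off the mesh points, a truncated power function: the jump of
the polynomial pieces at `t_j` is expanded in powers of `t - t_j`, and the jumps telescope. -/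
theorem exists_eq_kernelSum_of_piecewise_isPoly {E : Type*} [NormedAddCommGroup E]
    [NormedSpace ℝ E] {T : ℝ} {M : TimeMesh T} {p : ℕ → ℕ} {U : ℝ → E}
    (hU : ∀ n, 1 ≤ n → n ≤ M.N →
      ∃ P : ℝ → E, IsPoly (p n) P ∧ EqOn U P (Ioo (M.t (n - 1)) (M.t n))) :
    ∃ (Q : ℕ) (c : ℕ × ℕ → E), ∀ n ≤ M.N, ∀ t ∈ Ioo 0 (M.t n), t ∉ range M.t →
      U t = kernelSum (Finset.range n ×ˢ Finset.range (Q + 1)) (fun z => (z.2 : ℝ) + 1)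
        (fun z => M.t z.1) c t := by
  let Q := ∑ j ∈ Finset.range (M.N + 1), p j
  have hpieces : ∀ j, ∃ P : ℝ → E, IsPoly Q P ∧ (j = 0 → P = fun _ => 0) ∧
      (1 ≤ j → j ≤ M.N → EqOn U P (Ioo (M.t (j - 1)) (M.t j))) := by
    intro j
    by_cases hj : 1 ≤ j ∧ j ≤ M.N
    · obtain ⟨P, hP, hUP⟩ := hU j hj.1 hj.2
      refine ⟨P, hP.mono ?_, by lia, fun _ _ => hUP⟩
      exact Finset.single_le_sum (f := p) (fun _ _ => Nat.zero_le _)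
        (Finset.mem_range.2 (by lia))
    · exact ⟨fun _ => 0, IsPoly.zero Q, fun _ => rfl, fun h h' => absurd ⟨h, h'⟩ hj⟩
  choose P hP hP0 hUP using hpieces
  choose c hc using fun j => ((hP (j + 1)).sub (hP j)).exists_eq_sum_sub_pow (M.t j)
  refine ⟨Q, fun z => Real.Gamma (z.2 + 1) • c z.1 z.2, fun n hn t ht htM => ?_⟩
  obtain ⟨l, hl, htl⟩ := M.exists_mem_Ioo hn ht htM
  have hterm : ∀ j ∈ Finset.range n, ∑ k ∈ Finset.range (Q + 1),
      causalKernel ((k : ℝ) + 1) (t - M.t j) • Real.Gamma ((k : ℝ) + 1) • c j k =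
        if j < l + 1 then P (j + 1) t - P j t else 0 := by
    intro j hj
    have hjn := Finset.mem_range.1 hj
    split_ifs with h
    · have hx : 0 < t - M.t j := sub_pos.2 ((M.t_le (by lia) (by lia)).trans_lt htl.1)
      rw [hc j t]
      refine Finset.sum_congr rfl fun k _ => ?_
      have := (Real.Gamma_pos_of_pos (show (0 : ℝ) < k + 1 by positivity)).ne'
      rw [smul_smul, causalKernel_natCast_add_one k hx, div_mul_cancel₀ _ this]
    · refine Finset.sum_eq_zero fun k _ => ?_
      have : M.t (l + 1) ≤ M.t j := M.t_le (by lia) (by lia)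
      rw [causalKernel_of_nonpos (by linarith [htl.2]), zero_smul]
  rw [kernelSum, Finset.sum_product, Finset.sum_congr rfl hterm, ← Finset.sum_filter,
    show (Finset.range n).filter (· < l + 1) = Finset.range (l + 1) by ext; simp; lia,
    Finset.sum_range_sub (fun j => P j t), hP0 0 rfl, sub_zero]
  exact hUP (l + 1) (by lia) (by lia) htl

/-! ### Young's inequality for the pairing of the source with the solution -/

section Abstract

variable {ι : Type*} {E : Type*} [NormedAddCommGroup E] [InnerProductSpace ℝ E] [CompleteSpace E]
  {S : Finset ι} {m a : ι → ℝ} {c : ι → E}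

/-- `I^{-α} 𝓑_α V = V` on `(0, b)` for a truncated power function `V`, whose derivative `𝓑_α V` has
the exponents shifted by `α`. Causality makes the values beyond `b` irrelevant. -/
theorem integral_causalKernel_smul_indicator_kernelSum {α b t : ℝ} (hα : -1 < α) (hα0 : α < 0)
    (hm : ∀ i ∈ S, 1 ≤ m i) (ha : ∀ i ∈ S, 0 ≤ a i) (ht : t ∈ Ioo 0 b) :
    ∫ s, causalKernel (-α) (t - s) •
      (Ioo 0 b).indicator (kernelSum S (fun i => m i + α) a c) s = kernelSum S m a c t := by
  have h : ∀ s, causalKernel (-α) (t - s) •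
      (Ioo 0 b).indicator (kernelSum S (fun i => m i + α) a c) s =
      causalKernel (-α) (t - s) • kernelSum S (fun i => m i + α) a c s := by
    intro s
    by_cases hs : s ∈ Ioo 0 b
    · rw [indicator_of_mem hs]
    · rw [indicator_of_notMem hs, smul_zero]
      rcases le_or_gt s 0 with h | h
      · rw [kernelSum_of_nonpos ha h, smul_zero]
      · rw [causalKernel_of_nonpos, zero_smul]
        by_contra h'
        exact hs ⟨h, by linarith [ht.2]⟩
  simp only [h]
  rw [integral_causalKernel_smul_kernelSum (by linarith) (fun i hi => by linarith [hm i hi])]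
  simp only [add_neg_cancel_right]

theorem dConst_eq (α : ℝ) : dConst α = (Real.cos (Real.pi * (-α / 2)))⁻¹ := by
  rw [dConst, one_div, show Real.pi * (-α / 2) = -(α * Real.pi / 2) by ring, Real.cos_neg]

/-- Since `V = I^{-α} 𝓑_α V`, the pairing of a truncated power function `V` with `W` is the form of
`𝓑_α V` and `W`. -/
theorem integrableOn_and_integral_inner_kernelSum {α b : ℝ} (hα : -1 < α) (hα0 : α < 0)
    (hm : ∀ i ∈ S, 1 ≤ m i) (ha : ∀ i ∈ S, 0 ≤ a i) {W : ℝ → E} (hW : Integrable W)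
    (hW0 : ∀ t, t ∉ Ioo 0 b → W t = 0) :
    IntegrableOn (fun t => inner ℝ (kernelSum S m a c t) (W t)) (Ioo 0 b) ∧
    ∫ t in Ioo 0 b, inner ℝ (kernelSum S m a c t) (W t) =
      causalForm (-α) ((Ioo 0 b).indicator (kernelSum S (fun i => m i + α) a c)) W := by
  have hm' : ∀ i ∈ S, 0 < m i + α := fun i hi => by linarith [hm i hi]
  have hg : Integrable ((Ioo 0 b).indicator (kernelSum S (fun i => m i + α) a c)) :=
    (integrable_indicator_iff measurableSet_Ioo).2
      ((integrableOn_kernelSum hm' b).mono_set Ioo_subset_Iio_self)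
  have hform := causalFormIntegrable_kernelSum (S := S) (a := a) (c := c) (b := b) (μ := -α)
    (by linarith) hm' (fun i hi => by linarith [hm i hi]) hW
    (fun s hs => hW0 s fun h => absurd h.2 hs.not_gt)
  obtain ⟨h1, h2⟩ := hform.integrable_and_eq_integral
    (ae_integrable_causalKernel_smul (b := 0) (by linarith) hg
      (fun s hs => indicator_of_notMem (fun h => absurd h.1 hs.not_gt) _))
  constructor
  · refine h1.integrableOn.congr_fun (fun t ht => ?_) measurableSet_Ioo
    simp only [integral_causalKernel_smul_indicator_kernelSum hα hα0 hm ha ht]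
  · have hsupp : ∀ t, t ∉ Ioo 0 b → inner ℝ (∫ s, causalKernel (-α) (t - s) •
        (Ioo 0 b).indicator (kernelSum S (fun i => m i + α) a c) s) (W t) = 0 :=
      fun t ht => by rw [hW0 t ht, inner_zero_right]
    rw [h2, ← setIntegral_eq_integral_of_forall_compl_eq_zero hsupp]
    refine setIntegral_congr_fun measurableSet_Ioo fun t ht => ?_
    simp only [integral_causalKernel_smul_indicator_kernelSum hα hα0 hm ha ht]

/-- The sector inequality for `g = 𝓑_α V`, written in terms of the truncated power function `V`. -/
theorem two_mul_integral_inner_kernelSum_le {α b : ℝ} (hα : -1 < α) (hα0 : α < 0)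
    (hm : ∀ i ∈ S, 1 ≤ m i) (ha : ∀ i ∈ S, 0 ≤ a i) {W : ℝ → E} (hW : Integrable W)
    (hW0 : ∀ t, t ∉ Ioo 0 b → W t = 0) (hWW : CausalFormIntegrable (-α) W W) :
    IntegrableOn (fun t => inner ℝ (kernelSum S m a c t)
      (kernelSum S (fun i => m i + α) a c t)) (Ioo 0 b) ∧
    ∀ r : ℝ, 0 < r → 2 * ∫ t in Ioo 0 b, inner ℝ (kernelSum S m a c t) (W t) ≤
      r * (∫ t in Ioo 0 b, inner ℝ (kernelSum S m a c t)
        (kernelSum S (fun i => m i + α) a c t)) +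
      dConst α ^ 2 / r * causalForm (-α) W W := by
  have hm' : ∀ i ∈ S, 0 < m i + α := fun i hi => by linarith [hm i hi]
  have hg : Integrable ((Ioo 0 b).indicator (kernelSum S (fun i => m i + α) a c)) :=
    (integrable_indicator_iff measurableSet_Ioo).2
      ((integrableOn_kernelSum hm' b).mono_set Ioo_subset_Iio_self)
  have hg0 : ∀ t, t ∉ Ioo 0 b →
      (Ioo 0 b).indicator (kernelSum S (fun i => m i + α) a c) t = 0 :=
    fun t ht => indicator_of_notMem ht _
  obtain ⟨i1, e1⟩ := integrableOn_and_integral_inner_kernelSum (c := c) hα hα0 hm ha hg hg0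
  obtain ⟨-, e2⟩ := integrableOn_and_integral_inner_kernelSum (c := c) hα hα0 hm ha hW hW0
  have hform : ∀ {W : ℝ → E}, Integrable W → (∀ t, t ∉ Ioo 0 b → W t = 0) →
      CausalFormIntegrable (-α) ((Ioo 0 b).indicator (kernelSum S (fun i => m i + α) a c)) W :=
    fun hW hW0 => causalFormIntegrable_kernelSum (by linarith) hm'
      (fun i hi => by linarith [hm i hi]) hW (fun s hs => hW0 s fun h => absurd h.2 hs.not_gt)
  have hind : ∀ t ∈ Ioo 0 b, inner ℝ (kernelSum S m a c t)
      ((Ioo 0 b).indicator (kernelSum S (fun i => m i + α) a c) t) =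
      inner ℝ (kernelSum S m a c t) (kernelSum S (fun i => m i + α) a c t) := fun t ht => by
    rw [indicator_of_mem ht]
  refine ⟨i1.congr_fun hind measurableSet_Ioo, fun r hr => ?_⟩
  have h2 : 2 * (-α / 2) = -α := by ring
  have key := two_mul_causalForm_le (a := -α / 2) (b := 0) (T := b) (by linarith) (by linarith) hg
    (fun s hs => hg0 s fun h => absurd h.1 hs.not_gt) hW
    (fun s hs => hW0 s fun h => absurd h.2 hs.not_gt)
    (by rw [h2]; exact hform hg hg0) (by rw [h2]; exact hform hW hW0) (by rwa [h2]) hr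
  rw [h2, ← e1, ← e2, setIntegral_congr_fun measurableSet_Ioo hind, ← dConst_eq] at key
  exact key

end Abstract

section Source

variable {d : ℕ} {Ω : Set (EuclideanSpace ℝ (Fin d))}

theorem map_kernelSum {ι E F : Type*} [NormedAddCommGroup E] [NormedSpace ℝ E]
    [NormedAddCommGroup F] [NormedSpace ℝ F] (L : E →L[ℝ] F) (S : Finset ι) (m a : ι → ℝ)
    (c : ι → E) (t : ℝ) : L (kernelSum S m a c t) = kernelSum S m a (fun i => L (c i)) t := by
  simp [kernelSum]

/-- The data condition on `f` is the absolute convergence of the form of `W = ∇A⁻¹f`, since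
`⟨F, A⁻¹F'⟩ = K ⟨∇A⁻¹F, ∇A⁻¹F'⟩`. -/
theorem causalFormIntegrable_grad_invA {K α T b : ℝ} (hK : 0 < K) (hbT : b ≤ T)
    {f : ℝ → L2 Ω}
    (hfA : IntegrableOn (fun z : ℝ × ℝ => omega (-α) (z.2 - z.1) *
        inner ℝ (f z.1) (toL2 (invA K (f z.2))))
      {z : ℝ × ℝ | 0 < z.1 ∧ z.1 < z.2 ∧ z.2 < T} volume)
    {A : L2 Ω →L[ℝ] H10 Ω} (hA : ∀ F, SolvesA K F (A F) ∧ invA K F = A F) :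
    CausalFormIntegrable (-α) ((Ioo 0 b).indicator fun t => gradL Ω (A (f t)))
      ((Ioo 0 b).indicator fun t => gradL Ω (A (f t))) := by
  have hmeas : MeasurableSet {z : ℝ × ℝ | 0 < z.1 ∧ z.1 < z.2 ∧ z.2 < b} := by
    refine IsOpen.measurableSet ?_
    exact (isOpen_lt continuous_const continuous_fst).inter
      ((isOpen_lt continuous_fst continuous_snd).inter (isOpen_lt continuous_snd continuous_const))
  have h1 := hfA.mono_set (s := {z : ℝ × ℝ | 0 < z.1 ∧ z.1 < z.2 ∧ z.2 < b})
    fun z hz => ⟨hz.1, hz.2.1, hz.2.2.trans_le hbT⟩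
  have h2 := ((integrable_indicator_iff hmeas).2 h1).const_mul K⁻¹
  refine h2.congr (Filter.Eventually.of_forall fun z => ?_)
  beta_reduce
  by_cases hz : z ∈ {z : ℝ × ℝ | 0 < z.1 ∧ z.1 < z.2 ∧ z.2 < b}
  · have hz' := hz
    obtain ⟨ha, hb, hc⟩ := hz'
    rw [indicator_of_mem hz, indicator_of_mem (show z.1 ∈ Ioo 0 b from ⟨ha, hb.trans hc⟩),
      indicator_of_mem (show z.2 ∈ Ioo 0 b from ⟨ha.trans hb, hc⟩),
      causalKernel_of_pos (sub_pos.2 hb), omega, (hA (f z.2)).2, ← (hA (f z.1)).1, bilinA,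
      gradL_apply, gradL_apply]
    field_simp
  · rw [indicator_of_notMem hz, mul_zero]
    by_cases h1 : z.1 ∈ Ioo 0 b
    · by_cases h2 : z.2 ∈ Ioo 0 b
      · rw [causalKernel_of_nonpos, zero_mul]
        by_contra h3
        exact hz ⟨h1.1, by linarith, h2.2⟩
      · rw [indicator_of_notMem h2, inner_zero_right, mul_zero]
    · rw [indicator_of_notMem h1, inner_zero_left, mul_zero]

/-- On `(0, b)` the function `⟨I^{-α}f, A⁻¹f⟩` is `K` times the pairing of `I^{-α}W` with `W`. -/
theorem ae_inner_fracInt_invA_eq {K α b : ℝ} (hα0 : α < 0) {f : ℝ → L2 Ω}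
    (hf : IntegrableOn f (Ioo 0 b))
    {A : L2 Ω →L[ℝ] H10 Ω} (hA : ∀ F, SolvesA K F (A F) ∧ invA K F = A F) :
    ∀ᵐ t, t ∈ Ioo 0 b → inner ℝ (fracInt (-α) f t) (toL2 (invA K (f t))) =
      K * inner ℝ (∫ s, causalKernel (-α) (t - s) •
        (Ioo 0 b).indicator (fun t => gradL Ω (A (f t))) s)
        ((Ioo 0 b).indicator (fun t => gradL Ω (A (f t))) t) := by
  have hf' : Integrable ((Ioo 0 b).indicator f) := (integrable_indicator_iff measurableSet_Ioo).2 hf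
  filter_upwards [ae_integrable_causalKernel_smul (μ := -α) (b := 0) (by linarith) hf'
    (fun s hs => indicator_of_notMem (fun h => absurd h.1 hs.not_gt) _)] with t ht htb
  have e1 : fracInt (-α) f t =
      ∫ s, causalKernel (-α) (t - s) • (Ioo 0 b).indicator f s :=
    fracInt_eq_integral_causalKernel (-α) htb.1.le
      (fun s hs => indicator_of_notMem (fun h => absurd h.1 hs.not_gt) _)
      (Filter.Eventually.of_forall fun s hs => by
        rw [indicator_of_mem (show s ∈ Ioo 0 b from ⟨hs.1, hs.2.trans htb.2⟩)])
  have e2 : gradL Ω (A (fracInt (-α) f t)) = ∫ s, causalKernel (-α) (t - s) •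
      (Ioo 0 b).indicator (fun t => gradL Ω (A (f t))) s := by
    rw [e1, ← ContinuousLinearMap.comp_apply, ← ContinuousLinearMap.integral_comp_comm _ ht]
    refine integral_congr_ae (Filter.Eventually.of_forall fun s => ?_)
    simp only [map_smul]
    by_cases hs : s ∈ Ioo 0 b
    · rw [indicator_of_mem hs, indicator_of_mem hs, ContinuousLinearMap.comp_apply]
    · rw [indicator_of_notMem hs, indicator_of_notMem hs, map_zero]
  rw [indicator_of_mem htb, ← e2, (hA (f t)).2, ← (hA _).1, bilinA, gradL_apply, gradL_apply]

variable {ι : Type*} {S : Finset ι} {m a : ι → ℝ} {c : ι → H10 Ω}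

/-- The consequence of the sector inequality for the scheme: with `W = ∇A⁻¹f`, the three time
integrals are the forms `Φ(g, g)`, `Φ(W, W)` and `Φ(g, W)`, where `g = ∇𝓑_αU`. -/
theorem two_mul_integral_inner_source_le (hd : 1 ≤ d) (hΩb : Bornology.IsBounded Ω) {K : ℝ}
    (hK : 0 < K) {α b T : ℝ} (hα : -1 < α) (hα0 : α < 0) (hb : 0 ≤ b) (hbT : b ≤ T)
    {f : ℝ → L2 Ω} (hf : IntegrableOn f (Ioo 0 b))
    (hfA : IntegrableOn (fun z : ℝ × ℝ => omega (-α) (z.2 - z.1) *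
        inner ℝ (f z.1) (toL2 (invA K (f z.2))))
      {z : ℝ × ℝ | 0 < z.1 ∧ z.1 < z.2 ∧ z.2 < T} volume)
    (hm : ∀ i ∈ S, 1 ≤ m i) (ha : ∀ i ∈ S, 0 ≤ a i) {U : ℝ → H10 Ω}
    (hU : ∀ᵐ t, t ∈ Ioo 0 b → U t = kernelSum S m a c t) :
    IntervalIntegrable (fun t => bilinA K (fracDeriv α U t) (U t)) volume 0 b ∧
    IntervalIntegrable (fun t => inner ℝ (fracInt (-α) f t) (toL2 (invA K (f t)))) volume 0 b ∧
    IntervalIntegrable (fun t => inner ℝ (f t) (toL2 (U t))) volume 0 b ∧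
    ∀ r : ℝ, 0 < r → 2 * ∫ t in (0 : ℝ)..b, inner ℝ (f t) (toL2 (U t)) ≤
      r * (∫ t in (0 : ℝ)..b, bilinA K (fracDeriv α U t) (U t)) +
      dConst α ^ 2 / r *
        ∫ t in (0 : ℝ)..b, inner ℝ (fracInt (-α) f t) (toL2 (invA K (f t))) := by
  obtain ⟨A, hA⟩ := exists_invA_eq hd hΩb hK
  have hWW := causalFormIntegrable_grad_invA hK hbT hfA hA
  have hIW := ae_inner_fracInt_invA_eq (K := K) hα0 hf hA
  have hWi : Integrable ((Ioo 0 b).indicator fun t => gradL Ω (A (f t))) :=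
    (integrable_indicator_iff measurableSet_Ioo).2
      ((gradL Ω ∘L A).integrable_comp hf)
  have hW0 : ∀ t, t ∉ Ioo 0 b → (Ioo 0 b).indicator (fun t => gradL Ω (A (f t))) t = 0 :=
    fun t ht => indicator_of_notMem ht _
  have hWeq : ∀ t ∈ Ioo 0 b, (Ioo 0 b).indicator (fun t => gradL Ω (A (f t))) t =
      gradL Ω (A (f t)) := fun t ht => indicator_of_mem ht _
  set W := (Ioo 0 b).indicator (fun t => gradL Ω (A (f t)))
  obtain ⟨i1, key⟩ := two_mul_integral_inner_kernelSum_le (c := fun i => gradL Ω (c i)) hα hα0 hm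
    ha hWi hW0 hWW
  obtain ⟨i2, -⟩ := integrableOn_and_integral_inner_kernelSum (c := fun i => gradL Ω (c i)) hα hα0
    hm ha hWi hW0
  obtain ⟨i3, e3⟩ := hWW.integrable_and_eq_integral (ae_integrable_causalKernel_smul (b := 0)
    (by linarith) hWi (fun s hs => hW0 s fun h => absurd h.1 hs.not_gt))
  -- The three integrands, almost everywhere on `(0, b)`.
  have q1 : ∀ᵐ t, t ∈ Ioo 0 b → K * inner ℝ (kernelSum S m a (fun i => gradL Ω (c i)) t)
      (kernelSum S (fun i => m i + α) a (fun i => gradL Ω (c i)) t) =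
      bilinA K (fracDeriv α U t) (U t) := by
    have hne : ∀ᵐ t : ℝ, t ∉ a '' S := (S.countable_toSet.image a).ae_notMem volume
    filter_upwards [hU, hne] with t ht hta htb
    rw [ht htb, fracDeriv_eq_kernelSum hα (fun i hi => by linarith [hm i hi])
      (fun i hi => by linarith [hm i hi]) ha hU htb
      (fun i hi h => hta ⟨i, hi, h.symm⟩), bilinA, ← gradL_apply, ← gradL_apply, map_kernelSum,
      map_kernelSum, real_inner_comm]
  have q2 : ∀ᵐ t, t ∈ Ioo 0 b → K * inner ℝ (kernelSum S m a (fun i => gradL Ω (c i)) t) (W t) =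
      inner ℝ (f t) (toL2 (U t)) := by
    filter_upwards [hU] with t ht htb
    rw [ht htb, ← (hA (f t)).1, bilinA, ← gradL_apply, ← gradL_apply, map_kernelSum,
      real_inner_comm, hWeq t htb]
  have q3 : ∀ᵐ t, t ∈ Ioo 0 b → K * inner ℝ (∫ s, causalKernel (-α) (t - s) • W s) (W t) =
      inner ℝ (fracInt (-α) f t) (toL2 (invA K (f t))) := by
    filter_upwards [hIW] with t ht htb
    exact (ht htb).symm
  have hconv : ∀ {h k : ℝ → ℝ}, (∀ᵐ t, t ∈ Ioo 0 b → K * h t = k t) →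
      (IntegrableOn h (Ioo 0 b) → IntervalIntegrable k volume 0 b) ∧
      ∫ t in (0 : ℝ)..b, k t = K * ∫ t in Ioo 0 b, h t := by
    intro h k hhk
    constructor
    · intro hi
      rw [intervalIntegrable_iff_integrableOn_Ioo_of_le hb]
      exact (Integrable.const_mul hi K).congr
        ((ae_restrict_iff' measurableSet_Ioo).2 hhk)
    · rw [intervalIntegral.integral_of_le hb, integral_Ioc_eq_integral_Ioo, ← integral_const_mul]
      exact (setIntegral_congr_ae measurableSet_Ioo hhk).symm
  refine ⟨(hconv q1).1 i1, (hconv q3).1 i3.integrableOn, (hconv q2).1 i2, fun r hr => ?_⟩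
  have hsupp : ∀ t, t ∉ Ioo 0 b →
      inner ℝ (∫ s, causalKernel (-α) (t - s) • W s) (W t) = 0 :=
    fun t ht => by rw [hW0 t ht, inner_zero_right]
  rw [(hconv q1).2, (hconv q2).2, (hconv q3).2,
    setIntegral_eq_integral_of_forall_compl_eq_zero hsupp, ← e3]
  have := mul_le_mul_of_nonneg_left (key r hr) hK.le
  calc _ = K * (2 * ∫ t in Ioo 0 b,
          inner ℝ (kernelSum S m a (fun i => gradL Ω (c i)) t) (W t)) := by ring
    _ ≤ _ := this
    _ = _ := by ring

end Source

/-! ### The energy identity -/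

section Energy

theorem intervalIntegral_congr_Ioo {a b : ℝ} (hab : a ≤ b) {h k : ℝ → ℝ}
    (hhk : EqOn h k (Ioo a b)) : ∫ t in a..b, h t = ∫ t in a..b, k t := by
  rw [intervalIntegral.integral_of_le hab, intervalIntegral.integral_of_le hab,
    integral_Ioc_eq_integral_Ioo, integral_Ioc_eq_integral_Ioo]
  exact setIntegral_congr_fun measurableSet_Ioo hhk

variable {d : ℕ} {Ω : Set (EuclideanSpace ℝ (Fin d))} {T : ℝ} {M : TimeMesh T} {p : ℕ → ℕ}

theorem tracePlus_eq_of_eqOn {U P : ℝ → H10 Ω} {n : ℕ} (hP : Continuous P) {b : ℝ}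
    (hb : M.t n < b) (hUP : EqOn U P (Ioo (M.t n) b)) : tracePlus M U n = toL2 (P (M.t n)) := by
  rw [tracePlus, rightLim_eq_of_tendsto]
  refine ((hP.tendsto (M.t n)).mono_left nhdsWithin_le_nhds).congr' ?_
  filter_upwards [Ioo_mem_nhdsGT hb] with t ht using (hUP ht).symm

theorem traceMinus_eq_of_eqOn {U P : ℝ → H10 Ω} {U₀ : L2 Ω} {n : ℕ} (hn : n ≠ 0)
    (hP : Continuous P) {b : ℝ} (hb : b < M.t n) (hUP : EqOn U P (Ioo b (M.t n))) :
    traceMinus M U₀ U n = toL2 (P (M.t n)) := by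
  rw [traceMinus, if_neg hn, leftLim_eq_of_tendsto]
  refine ((hP.tendsto (M.t n)).mono_left nhdsWithin_le_nhds).congr' ?_
  filter_upwards [Ioo_mem_nhdsLT hb] with t ht using (hUP ht).symm

theorem intervalIntegrable_and_integral_inner_deriv_self {q : ℕ} {P : ℝ → H10 Ω}
    (hP : IsPoly q P) (a b : ℝ) :
    IntervalIntegrable (fun t => inner ℝ (toL2 (deriv P t)) (toL2 (P t))) volume a b ∧
    ∫ t in a..b, inner ℝ (toL2 (deriv P t)) (toL2 (P t)) =
      (‖toL2 (P b)‖ ^ 2 - ‖toL2 (P a)‖ ^ 2) / 2 := by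
  have hc := hP.contDiff
  have hder : ∀ t, HasDerivAt (fun t => toL2L Ω (P t)) (toL2L Ω (deriv P t)) t := fun t =>
    (toL2L Ω).hasFDerivAt.comp_hasDerivAt t
      ((hc.differentiable (by simp)).differentiableAt (x := t)).hasDerivAt
  have hcont : Continuous fun t => inner ℝ (toL2L Ω (deriv P t)) (toL2L Ω (P t)) :=
    ((toL2L Ω).continuous.comp (hc.continuous_deriv (by simp))).inner
      ((toL2L Ω).continuous.comp hc.continuous)
  have hi : IntervalIntegrable (fun t => inner ℝ (toL2L Ω (deriv P t)) (toL2L Ω (P t)))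
      volume a b := hcont.intervalIntegrable a b
  have hsq : ∀ t, HasDerivAt (fun t => ‖toL2L Ω (P t)‖ ^ 2 / 2)
      (inner ℝ (toL2L Ω (deriv P t)) (toL2L Ω (P t))) t := by
    intro t
    refine ((hder t).norm_sq.div_const 2).congr_deriv ?_
    rw [real_inner_comm]; ring
  have h := intervalIntegral.integral_eq_sub_of_hasDerivAt (fun t _ => hsq t) hi
  refine ⟨hi, ?_⟩
  simp only [toL2L_apply] at h
  rw [h]; ring

variable {K α : ℝ} {f : ℝ → L2 Ω} {U₀ : L2 Ω} {U : ℝ → H10 Ω}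

/-- Testing the scheme on one interval with the solution itself. -/
theorem IsDGSolution.energy_step (hU : IsDGSolution K α M p f U₀ U) {n : ℕ} (hn : n + 1 ≤ M.N)
    (hi : IntervalIntegrable (fun t => bilinA K (fracDeriv α U t) (U t)) volume
      (M.t n) (M.t (n + 1))) :
    ‖traceMinus M U₀ U (n + 1)‖ ^ 2 + ‖tracePlus M U n - traceMinus M U₀ U n‖ ^ 2
        + 2 * ∫ t in M.t n..M.t (n + 1), bilinA K (fracDeriv α U t) (U t) =
      ‖traceMinus M U₀ U n‖ ^ 2 + 2 * ∫ t in M.t n..M.t (n + 1), inner ℝ (f t) (toL2 (U t)) := by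
  obtain ⟨P, hP, hUP⟩ := hU.1 (n + 1) (by lia) hn
  have hlt : M.t n < M.t (n + 1) := M.t_lt (n + 1) (by lia) hn
  rw [Nat.add_sub_cancel] at hUP
  have hPc := hP.contDiff.continuous
  have h := hU.2 (n + 1) (by lia) hn P hP
  rw [Nat.add_sub_cancel] at h
  have hplus := tracePlus_eq_of_eqOn hPc hlt hUP
  have hminus := traceMinus_eq_of_eqOn (U₀ := U₀) (Nat.succ_ne_zero n) hPc hlt hUP
  obtain ⟨i1, e1⟩ := intervalIntegrable_and_integral_inner_deriv_self hP (M.t n) (M.t (n + 1))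
  have c1 : ∫ t in M.t n..M.t (n + 1), (inner ℝ (toL2 (deriv U t)) (toL2 (P t))
      + bilinA K (fracDeriv α U t) (P t)) =
      ∫ t in M.t n..M.t (n + 1), (inner ℝ (toL2 (deriv P t)) (toL2 (P t))
      + bilinA K (fracDeriv α U t) (U t)) := by
    refine intervalIntegral_congr_Ioo hlt.le fun t ht => ?_
    have : deriv U t = deriv P t := (hUP.eventuallyEq_of_mem (isOpen_Ioo.mem_nhds ht)).deriv_eq
    simp only [this, hUP ht]
  have c2 : ∫ t in M.t n..M.t (n + 1), inner ℝ (f t) (toL2 (P t)) =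
      ∫ t in M.t n..M.t (n + 1), inner ℝ (f t) (toL2 (U t)) :=
    intervalIntegral_congr_Ioo hlt.le fun t ht => by simp only [hUP ht]
  rw [c1, c2, intervalIntegral.integral_add i1 hi, e1, ← hminus, ← hplus] at h
  rw [← h, norm_sub_sq_real, inner_sub_left, real_inner_self_eq_norm_sq, real_inner_comm]
  ring

/-- The energy balance up to `t_n`, with the squared jumps dropped. -/
theorem IsDGSolution.energy_le (hU : IsDGSolution K α M p f U₀ U)
    (hi : ∀ n ≤ M.N, IntervalIntegrable (fun t => bilinA K (fracDeriv α U t) (U t)) volume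
      0 (M.t n))
    (hi' : ∀ n ≤ M.N, IntervalIntegrable (fun t => inner ℝ (f t) (toL2 (U t))) volume 0 (M.t n))
    {n : ℕ} (hn : n ≤ M.N) :
    ‖traceMinus M U₀ U n‖ ^ 2 + 2 * ∫ t in (0 : ℝ)..M.t n, bilinA K (fracDeriv α U t) (U t) ≤
      ‖traceMinus M U₀ U 0‖ ^ 2 + 2 * ∫ t in (0 : ℝ)..M.t n, inner ℝ (f t) (toL2 (U t)) := by
  induction n with
  | zero => simp [M.t_zero]
  | succ n ih =>
    have ih := ih (by lia)
    have hA := (hi n (by lia)).symm.trans (hi (n + 1) hn)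
    have hF := (hi' n (by lia)).symm.trans (hi' (n + 1) hn)
    have hstep := hU.energy_step hn hA
    rw [← intervalIntegral.integral_add_adjacent_intervals (hi n (by lia)) hA,
      ← intervalIntegral.integral_add_adjacent_intervals (hi' n (by lia)) hF]
    nlinarith [sq_nonneg ‖tracePlus M U n - traceMinus M U₀ U n‖]

end Energy

end Subdiffusion

theorem mainTheorem3 {d : ℕ} (hd : 1 ≤ d) (Ω : Set (EuclideanSpace ℝ (Fin d)))
    (hΩ : IsOpen Ω) (hΩb : Bornology.IsBounded Ω) (K : ℝ) (hK : 0 < K)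
    (α : ℝ) (hα : -1 < α) (hα0 : α < 0) (T : ℝ) (hT : 0 < T)
    (M : Subdiffusion.TimeMesh T) (p : ℕ → ℕ)
    (f : ℝ → Subdiffusion.L2 Ω) (hf : IntervalIntegrable f MeasureTheory.volume 0 T)
    (hfA : MeasureTheory.IntegrableOn
      (fun z : ℝ × ℝ => Subdiffusion.omega (-α) (z.2 - z.1) *
        inner ℝ (f z.1) (Subdiffusion.toL2 (Subdiffusion.invA K (f z.2))))
      {z : ℝ × ℝ | 0 < z.1 ∧ z.1 < z.2 ∧ z.2 < T} MeasureTheory.volume)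
    (U₀ : Subdiffusion.L2 Ω) (U : ℝ → Subdiffusion.H10 Ω)
    (hU : Subdiffusion.IsDGSolution K α M p f U₀ U)
    (n : ℕ) (hn : 1 ≤ n) (hnN : n ≤ M.N) :
    IntervalIntegrable (fun t => Subdiffusion.bilinA K (Subdiffusion.fracDeriv α U t) (U t))
        MeasureTheory.volume 0 (M.t n) ∧
    IntervalIntegrable (fun t => inner ℝ (Subdiffusion.fracInt (-α) f t)
        (Subdiffusion.toL2 (Subdiffusion.invA K (f t)))) MeasureTheory.volume 0 (M.t n) ∧
    ‖Subdiffusion.traceMinus M U₀ U n‖ ^ 2 + ‖Subdiffusion.tracePlus M U (n - 1)‖ ^ 2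
        + 2 * ∫ t in (0 : ℝ)..M.t n,
            Subdiffusion.bilinA K (Subdiffusion.fracDeriv α U t) (U t)
      ≤ 4 * ‖Subdiffusion.traceMinus M U₀ U 0‖ ^ 2
        + 4 * Subdiffusion.dConst α ^ 2 *
          ∫ t in (0 : ℝ)..M.t n, |inner ℝ (Subdiffusion.fracInt (-α) f t)
            (Subdiffusion.toL2 (Subdiffusion.invA K (f t)))| := by
  obtain ⟨Q, c, hc⟩ := Subdiffusion.exists_eq_kernelSum_of_piecewise_isPoly hU.1
  have hjT : ∀ j ≤ M.N, M.t j ≤ T := fun j hj => (M.t_le hj le_rfl).trans_eq M.t_last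
  have hsrc := fun j (hj : j ≤ M.N) =>
    Subdiffusion.two_mul_integral_inner_source_le hd hΩb hK hα hα0 (M.t_nonneg hj) (hjT j hj)
      (((intervalIntegrable_iff_integrableOn_Ioo_of_le hT.le).1 hf).mono_set
        (Ioo_subset_Ioo_right (hjT j hj))) hfA
      (S := Finset.range j ×ˢ Finset.range (Q + 1)) (m := fun z => (z.2 : ℝ) + 1)
      (a := fun z => M.t z.1) (c := c) (fun z _ => by simp)
      (fun z hz => M.t_nonneg (by
        have := Finset.mem_range.1 (Finset.mem_product.1 hz).1
        lia))
      (U := U) (by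
        filter_upwards [M.ae_notMem_range] with t ht htb
        exact hc j hj t htb ht)
  have hiA := fun j hj => (hsrc j hj).1
  have hiF := fun j hj => (hsrc j hj).2.2.1
  obtain ⟨k, rfl⟩ : ∃ k, n = k + 1 := ⟨n - 1, by lia⟩
  have hk : k ≤ M.N := by lia
  refine ⟨hiA _ hnN, (hsrc _ hnN).2.1, ?_⟩
  rw [Nat.add_sub_cancel]
  -- Young's inequality with weight `2` up to `t_k` absorbs the whole form, and with weight `1` up
  -- to `t_{k+1}` half of it.
  have hyk := (hsrc k hk).2.2.2 2 two_pos
  have hyn := (hsrc (k + 1) hnN).2.2.2 1 one_pos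
  have hek := hU.energy_le hiA hiF hk
  have hen := hU.energy_step hnN ((hiA k hk).symm.trans (hiA (k + 1) hnN))
  have hsA := intervalIntegral.integral_add_adjacent_intervals (hiA k hk)
    ((hiA k hk).symm.trans (hiA (k + 1) hnN))
  have hsF := intervalIntegral.integral_add_adjacent_intervals (hiF k hk)
    ((hiF k hk).symm.trans (hiF (k + 1) hnN))
  have hGn := (le_abs_self _).trans
    (intervalIntegral.abs_integral_le_integral_abs (M.t_nonneg hnN)
      (f := fun t => inner ℝ (Subdiffusion.fracInt (-α) f t)
        (Subdiffusion.toL2 (Subdiffusion.invA K (f t)))) (μ := volume))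
  have hGk := (le_abs_self _).trans
    (intervalIntegral.abs_integral_le_integral_abs (M.t_nonneg hk)
      (f := fun t => inner ℝ (Subdiffusion.fracInt (-α) f t)
        (Subdiffusion.toL2 (Subdiffusion.invA K (f t)))) (μ := volume))
  have hGkn : ∫ t in (0 : ℝ)..M.t k, |inner ℝ (Subdiffusion.fracInt (-α) f t)
        (Subdiffusion.toL2 (Subdiffusion.invA K (f t)))| ≤
      ∫ t in (0 : ℝ)..M.t (k + 1), |inner ℝ (Subdiffusion.fracInt (-α) f t)
        (Subdiffusion.toL2 (Subdiffusion.invA K (f t)))| :=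
    intervalIntegral.integral_mono_interval le_rfl (M.t_nonneg hk) (M.t_le (by lia) hnN)
      (Filter.Eventually.of_forall fun _ => abs_nonneg _) (hsrc _ hnN).2.1.abs
  have hG0 : 0 ≤ ∫ t in (0 : ℝ)..M.t (k + 1), |inner ℝ (Subdiffusion.fracInt (-α) f t)
        (Subdiffusion.toL2 (Subdiffusion.invA K (f t)))| :=
    intervalIntegral.integral_nonneg (M.t_nonneg hnN) fun _ _ => abs_nonneg _
  have hd2 : 0 ≤ Subdiffusion.dConst α ^ 2 := sq_nonneg _
  have hplus : ‖Subdiffusion.tracePlus M U k‖ ≤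
      ‖Subdiffusion.tracePlus M U k - Subdiffusion.traceMinus M U₀ U k‖ +
        ‖Subdiffusion.traceMinus M U₀ U k‖ := by
    simpa using norm_add_le (Subdiffusion.tracePlus M U k - Subdiffusion.traceMinus M U₀ U k)
      (Subdiffusion.traceMinus M U₀ U k)
  have hplus2 : ‖Subdiffusion.tracePlus M U k‖ ^ 2 ≤
      2 * ‖Subdiffusion.tracePlus M U k - Subdiffusion.traceMinus M U₀ U k‖ ^ 2 +
        2 * ‖Subdiffusion.traceMinus M U₀ U k‖ ^ 2 := by
    refine (pow_le_pow_left₀ (norm_nonneg _) hplus 2).trans ?_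
    nlinarith [sq_nonneg (‖Subdiffusion.tracePlus M U k - Subdiffusion.traceMinus M U₀ U k‖ -
      ‖Subdiffusion.traceMinus M U₀ U k‖)]
  have hdk := mul_le_mul_of_nonneg_left (hGk.trans hGkn) hd2
  have hdn := mul_le_mul_of_nonneg_left hGn hd2
  have hd0 := mul_nonneg hd2 hG0
  have hm0 := sq_nonneg ‖Subdiffusion.traceMinus M U₀ U (k + 1)‖
  simp only [div_one, div_mul_eq_mul_div] at hyk hyn
  rw [mul_assoc 4]
  linarith
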